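/- Let $d\ge 1$ and $r\ge 3$ be integers, let $\mathbb T_r=(\mathbb Z/r\mathbb Z)^d$ be the discrete torus with its nearest-neighbour edges (each unordered pair $\{x,y\}$ of points differing by $\pm$ a unit vector is one edge), and let $\beta>0$. The Ising expectation on $\mathbb T_r$ is $$\langle F\rangle_\beta=\frac{\sum_\sigma F(\sigma)e^{-\beta H(\sigma)}}{\sum_\sigma e^{-\beta H(\sigma)}},\qquad H(\sigma)=-\sum_{\{x,y\}\text{ an edge}}\sigma_x\sigma_y,$$ with sums over all $\sigma:\mathbb T_r\to\{-1,+1\}$. Put $\chi(\beta)=\sum_{x\in\mathbb T_r}\langle\sigma_0\sigma_x\rangle_\beta$, $\mathsf B(\beta)=\sum_{x\in\mathbb T_r}\langle\sigma_0\sigma_x\rangle_\beta^2$ and $$U_{4,\beta}(0,x,y,z)=\langle\sigma_0\sigma_x\sigma_y\sigma_z\rangle_\beta-\langle\sigma_0\sigma_x\rangle_\beta\langle\sigma_y\sigma_z\rangle_\beta-\langle\sigma_0\sigma_y\rangle_\beta\langle\sigma_x\sigma_z\rangle_\beta-\langle\sigma_0\sigma_z\rangle_\beta\langle\sigma_x\sigma_y\rangle_\beta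 .$$ Then $\chi$ is differentiable at $\beta$ and $$\sum_{x,y,z\in\mathbb T_r}|U_{4,\beta}(0,x,y,z)|\ \ge\ \frac1{128d^2}\min\Big\{\beta\,\chi(\beta)^2\,\frac{\partial\chi}{\partial\beta}(\beta),\ \frac1{\mathsf B(\beta)}\Big(\frac{\partial\chi}{\partial\beta}(\beta)\Big)^2\Big\}.$$ -/

import Mathlib

/-- A spin configuration on a vertex set `V`: each spin is `+1` or `-1`. -/
abbrev SpinConfig (V : Type) : Type := V → ℤˣ

namespace Ising

/-- The spin at `x`, as a real number (`1` or `-1`). -/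
def spin {V : Type} (σ : SpinConfig V) (x : V) : ℝ := ((σ x : ℤ) : ℝ)

variable {V : Type} [Fintype V] [DecidableEq V] (G : SimpleGraph V) [DecidableRel G.Adj]

/-- The Hamiltonian `H(σ) = - ∑_{xy ∈ E} σ_x σ_y`; each unordered edge is counted once. -/
def hamiltonian (σ : SpinConfig V) : ℝ :=
  -∑ e ∈ G.edgeFinset, (e.map (spin σ)).mul

/-- The partition function `Z_β = ∑_σ exp(-β H(σ))`. -/
noncomputable def partitionFunction (β : ℝ) : ℝ :=
  ∑ σ : SpinConfig V, Real.exp (-β * hamiltonian G σ)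

/-- The Ising expectation `⟨F⟩_β` on the finite graph `G` at inverse temperature `β`. -/
noncomputable def expectation (β : ℝ) (F : SpinConfig V → ℝ) : ℝ :=
  (1 / partitionFunction G β) * ∑ σ : SpinConfig V, F σ * Real.exp (-β * hamiltonian G σ)

end Ising

/-- The discrete torus `(ℤ/rℤ)^d`. -/
abbrev Torus (d r : ℕ) : Type := Fin d → ZMod r

/-- The nearest-neighbour graph on the discrete torus: distinct `x`, `y` are adjacent when
they differ by plus or minus a unit vector. -/
def torusGraph (d r : ℕ) : SimpleGraph (Torus d r) :=
  SimpleGraph.fromRel fun x y => ∃ i : Fin d, y = x + Pi.single i 1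

instance torusGraphDecidableAdj (d r : ℕ) : DecidableRel (torusGraph d r).Adj := fun x y =>
  inferInstanceAs (Decidable (x ≠ y ∧
    ((∃ i : Fin d, y = x + Pi.single i 1) ∨ (∃ i : Fin d, x = y + Pi.single i 1))))

namespace TorusIsing

open Ising

variable (d r : ℕ) [NeZero r] (β : ℝ)

/-- The torus two-point function `⟨σ_x σ_y⟩_β`. -/
noncomputable def twoPoint (x y : Torus d r) : ℝ :=
  expectation (torusGraph d r) β fun σ => spin σ x * spin σ y

/-- The torus four-point function `⟨σ_w σ_x σ_y σ_z⟩_β`. -/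
noncomputable def fourPoint (w x y z : Torus d r) : ℝ :=
  expectation (torusGraph d r) β fun σ => spin σ w * spin σ x * spin σ y * spin σ z

/-- The torus susceptibility `χ(β) = ∑_x ⟨σ_0 σ_x⟩_β`. -/
noncomputable def susceptibility : ℝ :=
  ∑ x : Torus d r, twoPoint d r β 0 x

/-- The torus bubble diagram `B(β) = ∑_x ⟨σ_0 σ_x⟩_β ^ 2`. -/
noncomputable def bubble : ℝ :=
  ∑ x : Torus d r, twoPoint d r β 0 x ^ 2

/-- The torus Ursell function `U₄(w, x, y, z)`. -/
noncomputable def ursell4 (w x y z : Torus d r) : ℝ :=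
  fourPoint d r β w x y z
    - twoPoint d r β w x * twoPoint d r β y z
    - twoPoint d r β w y * twoPoint d r β x z
    - twoPoint d r β w z * twoPoint d r β x y

end TorusIsing

open Finset

set_option linter.unusedSectionVars false
set_option linter.unnecessarySeqFocus false

/-! Take two independent copies σ, τ of the model and write each doubled edge weight as 1 plus a
Mayer factor. That factor vanishes where the bonds of σ and τ disagree, so on a connected edge set τ
must be ±σ, and sources can be moved from one copy to the other. Sorting edge sets by the cluster K
of a site gives `corr_mul_corr`, a cluster form of the switching lemma: a product of correlations is
a sum over K, under a parity constraint, of cluster weights times correlations of the model with the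
edges touching K removed. For nonnegative couplings the weights are nonnegative.

Comparing such expansions shows that U₄ is -2 times `joint` (`corr_four`), and that `joint`
averages, over clusters K joining 0 to x, the loss suffered by the y–z correlation when K is removed
(`joint_eq`). The Ursell sum is therefore large as soon as removing a cluster costs much two-point
function.

To bound the loss below, the couplings touching K are only reduced by a factor 1 - t. The
first-order term of the Taylor expansion consists of truncated correlations, which sum to the
derivative of χ. The second-order term consists of third cumulants, which `cumulant_le` bounds by
products of two-point functions. Averaging over K uses the exact first moment
`sum_clusterWeight_mem` and the tree bound `sum_clusterWeight_mem_mem_le` for the second moment.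

On the torus this gives, for every t in [0,1], the lower bound 2(ta - t²b) with a = βχ²χ' and b =
48d²β²χ⁴B. The choice of t produces the two members of the minimum. -/

namespace PairIsing

open Ising

/-! ### Spin products, correlations and Griffiths' first inequality -/

section Basic

variable {V ι : Type} [Fintype V] [DecidableEq V] [Fintype ι] [DecidableEq ι]

theorem spin_mul (σ θ : SpinConfig V) (x : V) : spin (σ * θ) x = spin σ x * spin θ x := by
  simp [spin]

theorem spin_eq_or (σ : SpinConfig V) (x : V) : spin σ x = 1 ∨ spin σ x = -1 := by
  rcases Int.units_eq_one_or (σ x) with h | h <;> simp [spin, h]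

theorem spin_mul_self (σ : SpinConfig V) (x : V) : spin σ x * spin σ x = 1 := by
  rcases spin_eq_or σ x with h | h <;> simp [h]

theorem spin_neg (σ : SpinConfig V) (x : V) : spin (-σ) x = -spin σ x := by
  simp [spin]

/-- The product of the spins at the sites of a list. -/
def spinProd (l : List V) (σ : SpinConfig V) : ℝ := (l.map (spin σ)).prod

@[simp] theorem spinProd_nil (σ : SpinConfig V) : spinProd [] σ = 1 := rfl

@[simp] theorem spinProd_cons (x : V) (l : List V) (σ : SpinConfig V) :
    spinProd (x :: l) σ = spin σ x * spinProd l σ := by simp [spinProd]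

theorem spinProd_append (l l' : List V) (σ : SpinConfig V) :
    spinProd (l ++ l') σ = spinProd l σ * spinProd l' σ := by simp [spinProd]

theorem spinProd_mul (l : List V) (σ θ : SpinConfig V) :
    spinProd l (σ * θ) = spinProd l σ * spinProd l θ := by
  induction l with
  | nil => simp
  | cons x l ih => simp only [spinProd_cons, spin_mul, ih]; ring

theorem spinProd_eq_or (l : List V) (σ : SpinConfig V) :
    spinProd l σ = 1 ∨ spinProd l σ = -1 := by
  induction l with
  | nil => simp
  | cons x l ih => rcases ih with h | h <;> rcases spin_eq_or σ x with h' | h' <;> simp [h, h']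

theorem spinProd_neg (l : List V) (σ : SpinConfig V) :
    spinProd l (-σ) = (-1) ^ l.length * spinProd l σ := by
  induction l with
  | nil => simp
  | cons x l ih => simp only [spinProd_cons, spin_neg, ih, List.length_cons, pow_succ]; ring

theorem spinProd_filter_mul (P : V → Bool) (l : List V) (σ : SpinConfig V) :
    spinProd (l.filter P) σ * spinProd (l.filter (fun x => !P x)) σ = spinProd l σ := by
  induction l with
  | nil => simp
  | cons x l ih =>
    cases h : P x <;> simp [h, ← ih] <;> ring

/-- The bond variable of an edge. -/
def bond (E : ι → V × V) (e : ι) (σ : SpinConfig V) : ℝ := spin σ (E e).1 * spin σ (E e).2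

theorem bond_mul (E : ι → V × V) (e : ι) (σ θ : SpinConfig V) :
    bond E e (σ * θ) = bond E e σ * bond E e θ := by
  simp only [bond, spin_mul]; ring

theorem bond_neg (E : ι → V × V) (e : ι) (σ : SpinConfig V) : bond E e (-σ) = bond E e σ := by
  simp only [bond, spin_neg]; ring

theorem bond_eq_or (E : ι → V × V) (e : ι) (σ : SpinConfig V) :
    bond E e σ = 1 ∨ bond E e σ = -1 := by
  rcases spin_eq_or σ (E e).1 with h | h <;> rcases spin_eq_or σ (E e).2 with h' | h' <;>
    simp [bond, h, h']

/-- The Boltzmann weight with edge-dependent couplings. -/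
noncomputable def weight (E : ι → V × V) (J : ι → ℝ) (σ : SpinConfig V) : ℝ :=
  Real.exp (∑ e, J e * bond E e σ)

/-- The partition function with edge-dependent couplings. -/
noncomputable def part (E : ι → V × V) (J : ι → ℝ) : ℝ := ∑ σ : SpinConfig V, weight E J σ

/-- The correlation of the spins at the sites of a list. -/
noncomputable def corr (E : ι → V × V) (J : ι → ℝ) (l : List V) : ℝ :=
  (∑ σ : SpinConfig V, spinProd l σ * weight E J σ) / part E J

theorem part_pos (E : ι → V × V) (J : ι → ℝ) : 0 < part E J :=
  Finset.sum_pos (fun _ _ => Real.exp_pos _) Finset.univ_nonempty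

theorem sum_eq_corr_mul_part (E : ι → V × V) (J : ι → ℝ) (l : List V) :
    ∑ σ : SpinConfig V, spinProd l σ * weight E J σ = corr E J l * part E J := by
  rw [corr, div_mul_cancel₀ _ (part_pos E J).ne']

theorem corr_congr (E : ι → V × V) (J : ι → ℝ) {l l' : List V}
    (h : ∀ σ, spinProd l σ = spinProd l' σ) : corr E J l = corr E J l' := by
  simp only [corr, h]

@[simp] theorem corr_nil (E : ι → V × V) (J : ι → ℝ) : corr E J [] = 1 := by
  simp only [corr, spinProd_nil, one_mul]
  exact div_self (part_pos E J).ne'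

/-- The product is a ±1-valued character of the group of configurations: if it takes the value -1 at
some θ, translation by θ shows that the sum vanishes; otherwise it is identically 1. -/
theorem sum_spinProd_nonneg (l : List V) : 0 ≤ ∑ σ : SpinConfig V, spinProd l σ := by
  by_cases h : ∃ θ : SpinConfig V, spinProd l θ = -1
  · obtain ⟨θ, hθ⟩ := h
    have := Equiv.sum_comp (Equiv.mulRight θ) (fun σ : SpinConfig V => spinProd l σ)
    simp only [Equiv.coe_mulRight, spinProd_mul, hθ, ← Finset.sum_mul] at this
    linarith
  · push Not at h
    refine Finset.sum_nonneg fun σ _ => ?_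
    rcases spinProd_eq_or l σ with h' | h'
    · simp [h']
    · exact absurd h' (h σ)

/-- Griffiths' first inequality for products of affine functions of the bonds. -/
theorem sum_spinProd_mul_prod_nonneg (E : ι → V × V) (a b : ι → ℝ) (ha : ∀ e, 0 ≤ a e)
    (hb : ∀ e, 0 ≤ b e) (S : Finset ι) (l : List V) :
    0 ≤ ∑ σ : SpinConfig V, spinProd l σ * ∏ e ∈ S, (a e + b e * bond E e σ) := by
  induction S using Finset.induction_on generalizing l with
  | empty => simpa using sum_spinProd_nonneg l
  | insert e S he ih =>
    -- Expanding one factor adds the two ends of the edge to the source list, hence the induction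
    -- over all `l`.
    have : ∑ σ : SpinConfig V, spinProd l σ * ∏ e ∈ insert e S, (a e + b e * bond E e σ)
        = a e * ∑ σ : SpinConfig V, spinProd l σ * ∏ e ∈ S, (a e + b e * bond E e σ)
          + b e * ∑ σ : SpinConfig V, spinProd ((E e).1 :: (E e).2 :: l) σ *
              ∏ e ∈ S, (a e + b e * bond E e σ) := by
      rw [Finset.mul_sum, Finset.mul_sum, ← Finset.sum_add_distrib]
      refine Finset.sum_congr rfl fun σ _ => ?_
      rw [Finset.prod_insert he]
      simp only [spinProd_cons, bond]
      ring
    rw [this]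
    exact add_nonneg (mul_nonneg (ha e) (ih l)) (mul_nonneg (hb e) (ih _))

theorem exp_mul_bond (E : ι → V × V) (e : ι) (j : ℝ) (σ : SpinConfig V) :
    Real.exp (j * bond E e σ) = Real.cosh j + Real.sinh j * bond E e σ := by
  rcases bond_eq_or E e σ with h | h
  · simp [h, Real.cosh_add_sinh]
  · simp [h, ← sub_eq_add_neg, Real.cosh_sub_sinh]

theorem corr_nonneg (E : ι → V × V) {J : ι → ℝ} (hJ : ∀ e, 0 ≤ J e) (l : List V) :
    0 ≤ corr E J l := by
  refine div_nonneg ?_ (part_pos E J).le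
  simp only [weight, Real.exp_sum, exp_mul_bond]
  exact sum_spinProd_mul_prod_nonneg E _ _ (fun e => (Real.cosh_pos _).le)
    (fun e => Real.sinh_nonneg_iff.2 (hJ e)) _ l

theorem corr_pair_self (E : ι → V × V) (J : ι → ℝ) (x : V) : corr E J [x, x] = 1 := by
  rw [← corr_nil E J]
  exact corr_congr E J fun σ => by simp [spin_mul_self]

theorem corr_pair_comm (E : ι → V × V) (J : ι → ℝ) (x y : V) :
    corr E J [x, y] = corr E J [y, x] :=
  corr_congr E J fun σ => by simp [mul_comm]

/-! ### Clusters of edge sets -/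

/-- Two sites are linked when an edge of `ω` joins them. -/
def Linked (E : ι → V × V) (ω : Finset ι) (x y : V) : Prop :=
  ∃ e ∈ ω, ((E e).1 = x ∧ (E e).2 = y) ∨ ((E e).1 = y ∧ (E e).2 = x)

open Classical in
/-- The cluster of `x` in the graph with edge set `ω`. -/
noncomputable def cluster (E : ι → V × V) (ω : Finset ι) (x : V) : Finset V :=
  Finset.univ.filter (Relation.ReflTransGen (Linked E ω) x)

theorem mem_cluster {E : ι → V × V} {ω : Finset ι} {x y : V} :
    y ∈ cluster E ω x ↔ Relation.ReflTransGen (Linked E ω) x y := by simp [cluster]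

theorem mem_cluster_self (E : ι → V × V) (ω : Finset ι) (x : V) : x ∈ cluster E ω x :=
  mem_cluster.2 .refl

theorem Linked.symm {E : ι → V × V} {ω : Finset ι} {x y : V} (h : Linked E ω x y) :
    Linked E ω y x := by
  obtain ⟨e, he, h⟩ := h
  exact ⟨e, he, h.symm⟩

theorem cluster_eq_of_mem {E : ι → V × V} {ω : Finset ι} {x y : V} (h : y ∈ cluster E ω x) :
    cluster E ω y = cluster E ω x := by
  have hs : Std.Symm (Linked E ω) := ⟨fun _ _ h => h.symm⟩
  rw [mem_cluster] at h
  have h' : Relation.ReflTransGen (Linked E ω) y x := Std.Symm.symm _ _ h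
  ext z
  simp only [mem_cluster]
  exact ⟨h.trans, h'.trans⟩

theorem fst_mem_cluster_iff {E : ι → V × V} {ω : Finset ι} {x : V} {e : ι} (he : e ∈ ω) :
    (E e).1 ∈ cluster E ω x ↔ (E e).2 ∈ cluster E ω x := by
  simp only [mem_cluster]
  exact ⟨fun h => h.tail ⟨e, he, .inl ⟨rfl, rfl⟩⟩, fun h => h.tail ⟨e, he, .inr ⟨rfl, rfl⟩⟩⟩

/-- The edges with both ends in `K`. -/
def inner (E : ι → V × V) (K : Finset V) : Finset ι :=
  Finset.univ.filter fun e => (E e).1 ∈ K ∧ (E e).2 ∈ K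

/-- The edges with no end in `K`. -/
def outer (E : ι → V × V) (K : Finset V) : Finset ι :=
  Finset.univ.filter fun e => (E e).1 ∉ K ∧ (E e).2 ∉ K

theorem cluster_inter_inner {E : ι → V × V} {ω : Finset ι} {x : V} {K : Finset V}
    (h : cluster E ω x = K) : cluster E (ω ∩ inner E K) x = K := by
  subst h
  ext y
  constructor
  · intro hy
    rw [mem_cluster] at hy ⊢
    exact Relation.ReflTransGen.mono (fun a b ⟨e, he, h⟩ => ⟨e, (Finset.mem_inter.1 he).1, h⟩) _ _ hy
  · intro hy
    rw [mem_cluster] at hy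
    induction hy with
    | refl => exact mem_cluster_self _ _ _
    | tail hb hbc ih =>
      rw [mem_cluster] at ih ⊢
      refine ih.tail ?_
      obtain ⟨e, he, h⟩ := hbc
      refine ⟨e, Finset.mem_inter.2 ⟨he, ?_⟩, h⟩
      have hb' := mem_cluster.2 hb
      have hc := mem_cluster.2 (hb.tail ⟨e, he, h⟩)
      simp only [inner, Finset.mem_filter, Finset.mem_univ, true_and]
      rcases h with ⟨h1, h2⟩ | ⟨h1, h2⟩ <;> rw [h1, h2] <;> exact ⟨by assumption, by assumption⟩

theorem cluster_union_outer {E : ι → V × V} {ω η : Finset ι} {x : V} {K : Finset V}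
    (h : cluster E ω x = K) (hη : η ⊆ outer E K) : cluster E (ω ∪ η) x = K := by
  subst h
  ext y
  constructor
  · intro hy
    rw [mem_cluster] at hy
    induction hy with
    | refl => exact mem_cluster_self _ _ _
    | tail hb hbc ih =>
      obtain ⟨e, he, h⟩ := hbc
      rcases Finset.mem_union.1 he with he | he
      · have := fst_mem_cluster_iff (E := E) (x := x) he
        rcases h with ⟨h1, h2⟩ | ⟨h1, h2⟩ <;> rw [h1, h2] at this <;> tauto
      · have := hη he
        simp only [outer, Finset.mem_filter, Finset.mem_univ, true_and] at this
        rcases h with ⟨h1, h2⟩ | ⟨h1, h2⟩ <;> rw [h1, h2] at this <;> tauto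
  · intro hy
    rw [mem_cluster] at hy ⊢
    exact Relation.ReflTransGen.mono (fun a b ⟨e, he, h⟩ => ⟨e, Finset.mem_union_left _ he, h⟩) _ _ hy

open Classical in
/-- The edge sets inside `K` that connect `K`. -/
noncomputable def connecting (E : ι → V × V) (K : Finset V) : Finset (Finset ι) :=
  (inner E K).powerset.filter fun ω => ∀ x ∈ K, cluster E ω x = K

theorem mem_connecting_iff {E : ι → V × V} {K : Finset V} {ω : Finset ι} {o : V} (ho : o ∈ K) :
    ω ∈ connecting E K ↔ ω ⊆ inner E K ∧ cluster E ω o = K := by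
  simp only [connecting, Finset.mem_filter, Finset.mem_powerset]
  refine and_congr_right fun _ => ⟨fun h => h o ho, fun h x hx => ?_⟩
  rw [← h] at hx
  rw [cluster_eq_of_mem hx, h]

open Classical in
/-- Splitting a sum over edge sets according to the cluster of a site. -/
theorem sum_prod_cluster_eq (E : ι → V × V) (f : ι → ℝ) {K : Finset V} {o : V} (ho : o ∈ K) :
    ∑ ω ∈ Finset.univ.powerset.filter (fun ω => cluster E ω o = K), ∏ e ∈ ω, f e =
      (∑ ω ∈ connecting E K, ∏ e ∈ ω, f e) * ∏ e ∈ outer E K, (1 + f e) := by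
  rw [Finset.prod_one_add, Finset.sum_mul_sum, ← Finset.sum_product']
  have hdisj : Disjoint (inner E K) (outer E K) := by
    rw [Finset.disjoint_left]
    intro e
    simp only [inner, outer, Finset.mem_filter]
    tauto
  -- If K is a cluster of ω, no edge of ω leaves K. So ω is an edge set connecting K together with
  -- an arbitrary set of edges avoiding K, and the free choice of the latter gives the product of
  -- the `1 + f e`.
  refine Finset.sum_bij' (fun ω _ => (ω ∩ inner E K, ω ∩ outer E K)) (fun q _ => q.1 ∪ q.2)
    ?_ ?_ ?_ ?_ ?_
  · intro ω hω
    simp only [Finset.mem_filter] at hω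
    simp only [Finset.mem_product, mem_connecting_iff ho, Finset.mem_powerset]
    exact ⟨⟨Finset.inter_subset_right, cluster_inter_inner hω.2⟩, Finset.inter_subset_right⟩
  · intro q hq
    simp only [Finset.mem_product, mem_connecting_iff ho, Finset.mem_powerset] at hq
    simp only [Finset.mem_filter, Finset.mem_powerset, Finset.subset_univ, true_and]
    exact cluster_union_outer hq.1.2 hq.2
  · intro ω hω
    simp only [Finset.mem_filter] at hω
    ext e
    simp only [Finset.mem_union, Finset.mem_inter, inner, outer, Finset.mem_filter,
      Finset.mem_univ, true_and]
    constructor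
    · tauto
    · intro he
      have := fst_mem_cluster_iff (E := E) (x := o) he
      rw [hω.2] at this
      tauto
  · intro q hq
    simp only [Finset.mem_product, mem_connecting_iff ho, Finset.mem_powerset] at hq
    rw [Finset.disjoint_left] at hdisj
    ext e
    · simp only [Finset.mem_union, Finset.mem_inter]
      have h1 := @hq.1.1 e
      have h2 := @hq.2 e
      have h3 := @hdisj e
      tauto
    · simp only [Finset.mem_union, Finset.mem_inter]
      have h1 := @hq.1.1 e
      have h2 := @hq.2 e
      have h3 := @hdisj e
      tauto
  · intro ω hω
    simp only [Finset.mem_filter] at hω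
    rw [← Finset.prod_union]
    · refine Finset.prod_congr ?_ fun _ _ => rfl
      ext e
      simp only [Finset.mem_union, Finset.mem_inter, inner, outer, Finset.mem_filter,
        Finset.mem_univ, true_and]
      constructor
      · intro he
        have := fst_mem_cluster_iff (E := E) (x := o) he
        rw [hω.2] at this
        tauto
      · tauto
    · exact hdisj.mono Finset.inter_subset_right Finset.inter_subset_right

end Basic

/-! ### The switching lemma in cluster form -/

section Switching

variable {V ι : Type} [Fintype V] [DecidableEq V] [Fintype ι] [DecidableEq ι]

/-- The couplings after deletion of all edges touching `K`. -/
def cut (E : ι → V × V) (J : ι → ℝ) (K : Finset V) (e : ι) : ℝ :=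
  if e ∈ outer E K then J e else 0

theorem cut_nonneg (E : ι → V × V) {J : ι → ℝ} (hJ : ∀ e, 0 ≤ J e) (K : Finset V) (e : ι) :
    0 ≤ cut E J K e := by
  unfold cut; split_ifs <;> simp [hJ]

theorem cut_le (E : ι → V × V) {J : ι → ℝ} (hJ : ∀ e, 0 ≤ J e) (K : Finset V) (e : ι) :
    cut E J K e ≤ J e := by
  unfold cut; split_ifs <;> simp [hJ]

/-- The configuration equal to `σ` on `K` and to `τ` off `K`. -/
def mix (K : Finset V) (σ τ : SpinConfig V) : SpinConfig V := fun x => if x ∈ K then σ x else τ x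

/-- Independence of the spins on K and off K: exchanging the parts on K of two configurations is an
involution of pairs, and it turns `F a * G b` into a product at a single configuration. -/
theorem sum_mul_sum_of_involution {α : Type*} [Fintype α] (m : α → α → α)
    (hm : ∀ a b, m (m a b) (m b a) = a) (F G : α → ℝ) (hF : ∀ a b, F (m a b) = F a)
    (hG : ∀ a b, G (m a b) = G b) :
    (∑ a, F a) * ∑ a, G a = Fintype.card α * ∑ a, F a * G a := by
  let Φ : α × α ≃ α × α :=
    { toFun := fun q => (m q.1 q.2, m q.2 q.1)
      invFun := fun q => (m q.1 q.2, m q.2 q.1)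
      left_inv := fun q => by simp [hm]
      right_inv := fun q => by simp [hm] }
  rw [Finset.sum_mul_sum, ← Fintype.sum_prod_type' (fun a b => F a * G b)]
  have h1 : ∀ q : α × α, F q.1 * G q.2 = (fun q : α × α => F q.1 * G q.1) (Φ q) := fun q => by
    simp [Φ, hF, hG]
  rw [Fintype.sum_congr _ _ h1, Equiv.sum_comp Φ (fun q : α × α => F q.1 * G q.1),
    Fintype.sum_prod_type]
  simp [← Finset.mul_sum]

theorem spinProd_congr {l : List V} {σ τ : SpinConfig V} (h : ∀ x ∈ l, σ x = τ x) :
    spinProd l σ = spinProd l τ := by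
  unfold spinProd
  congr 1
  refine List.map_congr_left fun x hx => ?_
  simp [spin, h x hx]

theorem bond_congr {E : ι → V × V} {e : ι} {σ τ : SpinConfig V} (h1 : σ (E e).1 = τ (E e).1)
    (h2 : σ (E e).2 = τ (E e).2) : bond E e σ = bond E e τ := by
  simp [bond, spin, h1, h2]

/-- The doubled edge factor minus one. -/
noncomputable def mayer (E : ι → V × V) (J : ι → ℝ) (σ τ : SpinConfig V) (e : ι) : ℝ :=
  Real.exp (J e * (bond E e σ + bond E e τ)) - 1

theorem weight_mul_weight (E : ι → V × V) (J : ι → ℝ) (σ τ : SpinConfig V) :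
    weight E J σ * weight E J τ = ∏ e, (1 + mayer E J σ τ e) := by
  simp only [weight, mayer, add_sub_cancel, mul_add, Real.exp_add, Real.exp_sum,
    Finset.prod_mul_distrib]

theorem weight_cut_mul_weight_cut (E : ι → V × V) (J : ι → ℝ) (K : Finset V)
    (σ τ : SpinConfig V) :
    weight E (cut E J K) σ * weight E (cut E J K) τ =
      ∏ e ∈ outer E K, (1 + mayer E J σ τ e) := by
  rw [weight_mul_weight, ← Finset.prod_subset (Finset.subset_univ (outer E K))]
  · refine Finset.prod_congr rfl fun e he => ?_
    simp [mayer, cut, he]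
  · intro e _ he
    simp [mayer, cut, he]

/-- Where `bond E e θ = -1` the two bonds cancel in the exponent and the Mayer factor is 0. This is
what forces the copies to agree up to a sign on each cluster. -/
theorem prod_mayer_mul (E : ι → V × V) (J : ι → ℝ) (ω : Finset ι) (σ θ : SpinConfig V) :
    ∏ e ∈ ω, mayer E J σ (σ * θ) e =
      if ∀ e ∈ ω, bond E e θ = 1 then ∏ e ∈ ω, (Real.exp (2 * J e * bond E e σ) - 1) else 0 := by
  split_ifs with h
  · refine Finset.prod_congr rfl fun e he => ?_
    rw [mayer, bond_mul, h e he]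
    ring_nf
  · push Not at h
    obtain ⟨e, he, hne⟩ := h
    refine Finset.prod_eq_zero he ?_
    rw [mayer, bond_mul, (bond_eq_or E e θ).resolve_left hne]
    simp

theorem bond_eq_one_iff {E : ι → V × V} {e : ι} {θ : SpinConfig V} :
    bond E e θ = 1 ↔ θ (E e).1 = θ (E e).2 := by
  rcases Int.units_eq_one_or (θ (E e).1) with h | h <;>
    rcases Int.units_eq_one_or (θ (E e).2) with h' | h' <;> simp [bond, spin, h, h'] <;> norm_num

theorem bonds_eq_one_iff {E : ι → V × V} {K : Finset V} {ω : Finset ι} {o : V} (ho : o ∈ K)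
    (hω : ω ∈ connecting E K) (θ : SpinConfig V) :
    (∀ e ∈ ω, bond E e θ = 1) ↔ ∀ x ∈ K, θ x = θ o := by
  rw [mem_connecting_iff ho] at hω
  simp only [bond_eq_one_iff]
  constructor
  · intro h x hx
    rw [← hω.2, mem_cluster] at hx
    induction hx with
    | refl => rfl
    | tail _ hbc ih =>
      obtain ⟨e, he, hh⟩ := hbc
      rw [← ih]
      have := h e he
      rcases hh with ⟨h1, h2⟩ | ⟨h1, h2⟩ <;> rw [h1, h2] at this <;> simp [this]
  · intro h e he
    have := hω.1 he
    simp only [inner, Finset.mem_filter] at this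
    rw [h _ this.2.1, h _ this.2.2]

/-- The configurations that are constant on `K`. -/
def constOn (K : Finset V) : Finset (SpinConfig V) :=
  Finset.univ.filter fun θ => ∀ x ∈ K, ∀ y ∈ K, θ x = θ y

theorem mem_constOn_iff {K : Finset V} {o : V} (ho : o ∈ K) {θ : SpinConfig V} :
    θ ∈ constOn K ↔ ∀ x ∈ K, θ x = θ o := by
  simp only [constOn, Finset.mem_filter, Finset.mem_univ, true_and]
  exact ⟨fun h x hx => h x hx o ho, fun h x hx y hy => by rw [h x hx, h y hy]⟩

theorem spinProd_of_mem_constOn {K : Finset V} {o : V} (ho : o ∈ K) {θ : SpinConfig V}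
    (hθ : θ ∈ constOn K) {l : List V} (hl : ∀ x ∈ l, x ∈ K) :
    spinProd l θ = spin θ o ^ l.length := by
  rw [mem_constOn_iff ho] at hθ
  induction l with
  | nil => simp
  | cons x l ih =>
    rw [spinProd_cons, ih fun y hy => hl y (List.mem_cons_of_mem _ hy), List.length_cons, pow_succ']
    simp [spin, hθ x (hl x List.mem_cons_self)]

/-- Source of the parity constraint: for an even number of sites each product is 1, for an odd
number the global flip θ ↦ -θ cancels the sum. -/
theorem sum_constOn_spinProd {K : Finset V} {o : V} (ho : o ∈ K) {l : List V}
    (hl : ∀ x ∈ l, x ∈ K) :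
    ∑ θ ∈ constOn K, spinProd l θ = if Even l.length then ((constOn K).card : ℝ) else 0 := by
  split_ifs with h
  · rw [Finset.sum_congr rfl (g := fun _ => (1 : ℝ))]
    · simp
    · intro θ hθ
      rw [spinProd_of_mem_constOn ho hθ hl]
      rcases spin_eq_or θ o with h' | h' <;> simp [h', h]
  · have h1 : ∑ θ ∈ constOn K, spinProd l θ = ∑ θ ∈ constOn K, spinProd l (-θ) := by
      refine Finset.sum_nbij' (fun θ => -θ) (fun θ => -θ) ?_ ?_ ?_ ?_ ?_ <;>
        simp [constOn]
    have h2 : ∀ θ : SpinConfig V, spinProd l (-θ) = -spinProd l θ := fun θ => by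
      rw [spinProd_neg, (Nat.not_even_iff_odd.1 h).neg_one_pow]; ring
    simp only [h2, Finset.sum_neg_distrib] at h1
    linarith

/-- The weight of the edge sets connecting `K`, with sources. -/
noncomputable def connWeight (E : ι → V × V) (J : ι → ℝ) (K : Finset V) (l : List V) : ℝ :=
  ∑ ω ∈ connecting E K, ∑ σ : SpinConfig V,
    spinProd l σ * ∏ e ∈ ω, (Real.exp (2 * J e * bond E e σ) - 1)

theorem connWeight_nonneg (E : ι → V × V) {J : ι → ℝ} (hJ : ∀ e, 0 ≤ J e) (K : Finset V)
    (l : List V) : 0 ≤ connWeight E J K l := by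
  refine Finset.sum_nonneg fun ω _ => ?_
  -- Subtracting 1 keeps the constant coefficient nonnegative because cosh ≥ 1, so Griffiths' first
  -- inequality still applies.
  have h : ∀ e (σ : SpinConfig V), Real.exp (2 * J e * bond E e σ) - 1 =
      (Real.cosh (2 * J e) - 1) + Real.sinh (2 * J e) * bond E e σ := fun e σ => by
    rw [exp_mul_bond]; ring
  simp only [h]
  refine sum_spinProd_mul_prod_nonneg E _ _ (fun e => ?_) (fun e => ?_) _ _
  · linarith [Real.one_le_cosh (2 * J e)]
  · exact Real.sinh_nonneg_iff.2 (by linarith [hJ e])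

theorem connWeight_odd (E : ι → V × V) (J : ι → ℝ) (K : Finset V) {l : List V}
    (hl : ¬ Even l.length) : connWeight E J K l = 0 := by
  refine Finset.sum_eq_zero fun ω _ => ?_
  have := Equiv.sum_comp (Equiv.neg (SpinConfig V)) (fun σ : SpinConfig V =>
    spinProd l σ * ∏ e ∈ ω, (Real.exp (2 * J e * bond E e σ) - 1))
  simp only [Equiv.neg_apply, spinProd_neg, bond_neg,
    (Nat.not_even_iff_odd.1 hl).neg_one_pow, neg_mul, one_mul, Finset.sum_neg_distrib] at this
  linarith

/-- The switching identity inside a connected cluster. -/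
theorem sum_connecting (E : ι → V × V) (J : ι → ℝ) {K : Finset V} {o : V} (ho : o ∈ K)
    (A B : List V) (hB : ∀ x ∈ B, x ∈ K) :
    ∑ σ : SpinConfig V, ∑ τ : SpinConfig V, spinProd A σ * spinProd B τ *
        ∑ ω ∈ connecting E K, ∏ e ∈ ω, mayer E J σ τ e =
      (if Even B.length then ((constOn K).card : ℝ) else 0) * connWeight E J K (A ++ B) := by
  have h1 : ∀ σ : SpinConfig V, ∑ τ : SpinConfig V, spinProd A σ * spinProd B τ *
        ∑ ω ∈ connecting E K, ∏ e ∈ ω, mayer E J σ τ e =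
      ∑ θ ∈ constOn K, spinProd B θ * ∑ ω ∈ connecting E K, spinProd (A ++ B) σ *
        ∏ e ∈ ω, (Real.exp (2 * J e * bond E e σ) - 1) := fun σ => by
    -- Substitute τ = σθ; only θ constant on K survive, and the sources `B` of τ become sources of σ
    -- times a product in θ.
    rw [← Equiv.sum_comp (Equiv.mulLeft σ)]
    rw [← Finset.sum_subset (Finset.subset_univ (constOn K))]
    · refine Finset.sum_congr rfl fun θ hθ => ?_
      rw [Finset.mul_sum, Finset.mul_sum]
      refine Finset.sum_congr rfl fun ω hω => ?_
      rw [Equiv.coe_mulLeft, prod_mayer_mul,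
        if_pos ((bonds_eq_one_iff ho hω θ).2 ((mem_constOn_iff ho).1 hθ)), spinProd_mul,
        spinProd_append]
      ring
    · intro θ _ hθ
      rw [Finset.sum_eq_zero, mul_zero]
      intro ω hω
      rw [Equiv.coe_mulLeft, prod_mayer_mul, if_neg]
      rwa [bonds_eq_one_iff ho hω θ, ← mem_constOn_iff ho]
  rw [Finset.sum_congr rfl fun σ _ => h1 σ, ← sum_constOn_spinProd ho hB, Finset.sum_comm,
    Finset.sum_mul]
  refine Finset.sum_congr rfl fun θ _ => ?_
  rw [← Finset.mul_sum, connWeight, Finset.sum_comm]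

/-- The normalised weight of a cluster `K` with sources `l`. -/
noncomputable def clusterWeight (E : ι → V × V) (J : ι → ℝ) (K : Finset V) (l : List V) : ℝ :=
  (constOn K).card * connWeight E J K l * part E (cut E J K) ^ 2 /
    (Fintype.card (SpinConfig V × SpinConfig V) * part E J ^ 2)

theorem clusterWeight_nonneg (E : ι → V × V) {J : ι → ℝ} (hJ : ∀ e, 0 ≤ J e) (K : Finset V)
    (l : List V) : 0 ≤ clusterWeight E J K l := by
  have := connWeight_nonneg E hJ K l
  unfold clusterWeight
  positivity

theorem clusterWeight_odd (E : ι → V × V) (J : ι → ℝ) (K : Finset V) {l : List V}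
    (hl : ¬ Even l.length) : clusterWeight E J K l = 0 := by
  simp [clusterWeight, connWeight_odd E J K hl]

theorem clusterWeight_congr (E : ι → V × V) (J : ι → ℝ) (K : Finset V) {l l' : List V}
    (h : ∀ σ, spinProd l σ = spinProd l' σ) : clusterWeight E J K l = clusterWeight E J K l' := by
  simp only [clusterWeight, connWeight, h]

/-- The part of a list inside `K`. -/
def inPart (K : Finset V) (l : List V) : List V := l.filter (· ∈ K)

/-- The part of a list outside `K`. -/
def outPart (K : Finset V) (l : List V) : List V := l.filter (· ∉ K)

theorem spinProd_inPart_mul_outPart (K : Finset V) (l : List V) (σ : SpinConfig V) :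
    spinProd (inPart K l) σ * spinProd (outPart K l) σ = spinProd l σ := by
  have := spinProd_filter_mul (fun x => decide (x ∈ K)) l σ
  simpa [inPart, outPart] using this

/-- The summand factors into `F`, which sees only spins on K, and `G`, which sees only spins off K.
The first is evaluated by switching, the second is a product of two correlations of the cut model.
-/
theorem cluster_term (E : ι → V × V) (J : ι → ℝ) {K : Finset V} {o : V} (ho : o ∈ K)
    (A B : List V) :
    ∑ σ : SpinConfig V, ∑ τ : SpinConfig V, spinProd A σ * spinProd B τ *
        ((∑ ω ∈ connecting E K, ∏ e ∈ ω, mayer E J σ τ e) *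
          ∏ e ∈ outer E K, (1 + mayer E J σ τ e)) =
      (if Even (inPart K B).length then clusterWeight E J K (inPart K (A ++ B)) else 0) *
        corr E (cut E J K) (outPart K A) * corr E (cut E J K) (outPart K B) * part E J ^ 2 := by
  classical
  let F : SpinConfig V × SpinConfig V → ℝ := fun q =>
    spinProd (inPart K A) q.1 * spinProd (inPart K B) q.2 *
      ∑ ω ∈ connecting E K, ∏ e ∈ ω, mayer E J q.1 q.2 e
  let G : SpinConfig V × SpinConfig V → ℝ := fun q =>
    spinProd (outPart K A) q.1 * spinProd (outPart K B) q.2 *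
      ∏ e ∈ outer E K, (1 + mayer E J q.1 q.2 e)
  have key := sum_mul_sum_of_involution
    (fun a b : SpinConfig V × SpinConfig V => (mix K a.1 b.1, mix K a.2 b.2))
    (fun a b => by
      ext x
      · simp only [mix]; split_ifs <;> rfl
      · simp only [mix]; split_ifs <;> rfl) F G
    (fun a b => by
      have hin : ∀ x ∈ K, ∀ σ τ : SpinConfig V, mix K σ τ x = σ x := fun x hx σ τ => by
        simp [mix, hx]
      have hl : ∀ l : List V, ∀ x ∈ inPart K l, x ∈ K := fun l x hx => by
        simpa using (List.mem_filter.1 hx).2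
      simp only [F]
      rw [spinProd_congr fun x hx => hin x (hl _ x hx) a.1 b.1,
        spinProd_congr fun x hx => hin x (hl _ x hx) a.2 b.2]
      congr 1
      refine Finset.sum_congr rfl fun ω hω => Finset.prod_congr rfl fun e he => ?_
      have := ((mem_connecting_iff ho).1 hω).1 he
      simp only [inner, Finset.mem_filter] at this
      simp only [mayer]
      rw [bond_congr (hin _ this.2.1 a.1 b.1) (hin _ this.2.2 a.1 b.1),
        bond_congr (hin _ this.2.1 a.2 b.2) (hin _ this.2.2 a.2 b.2)])
    (fun a b => by
      have hout : ∀ x, x ∉ K → ∀ σ τ : SpinConfig V, mix K σ τ x = τ x := fun x hx σ τ => by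
        simp [mix, hx]
      have hl : ∀ l : List V, ∀ x ∈ outPart K l, x ∉ K := fun l x hx => by
        simpa using (List.mem_filter.1 hx).2
      simp only [G]
      rw [spinProd_congr fun x hx => hout x (hl _ x hx) a.1 b.1,
        spinProd_congr fun x hx => hout x (hl _ x hx) a.2 b.2]
      congr 1
      refine Finset.prod_congr rfl fun e he => ?_
      simp only [outer, Finset.mem_filter] at he
      simp only [mayer]
      rw [bond_congr (hout _ he.2.1 a.1 b.1) (hout _ he.2.2 a.1 b.1),
        bond_congr (hout _ he.2.1 a.2 b.2) (hout _ he.2.2 a.2 b.2)])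
  have hF : ∑ q, F q = (if Even (inPart K B).length then ((constOn K).card : ℝ) else 0) *
      connWeight E J K (inPart K (A ++ B)) := by
    rw [Fintype.sum_prod_type, sum_connecting E J ho (inPart K A) (inPart K B)]
    · simp [inPart]
    · intro x hx
      simpa using (List.mem_filter.1 hx).2
  have hG : ∑ q, G q = (corr E (cut E J K) (outPart K A) * part E (cut E J K)) *
      (corr E (cut E J K) (outPart K B) * part E (cut E J K)) := by
    rw [← sum_eq_corr_mul_part, ← sum_eq_corr_mul_part, Finset.sum_mul_sum, Fintype.sum_prod_type]
    refine Finset.sum_congr rfl fun σ _ => Finset.sum_congr rfl fun τ _ => ?_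
    simp only [G]
    rw [← weight_cut_mul_weight_cut]
    ring
  have hFG : ∑ q, F q * G q = ∑ σ : SpinConfig V, ∑ τ : SpinConfig V, spinProd A σ *
      spinProd B τ * ((∑ ω ∈ connecting E K, ∏ e ∈ ω, mayer E J σ τ e) *
          ∏ e ∈ outer E K, (1 + mayer E J σ τ e)) := by
    rw [Fintype.sum_prod_type]
    refine Finset.sum_congr rfl fun σ _ => Finset.sum_congr rfl fun τ _ => ?_
    simp only [F, G]
    rw [← spinProd_inPart_mul_outPart K A σ, ← spinProd_inPart_mul_outPart K B τ]
    ring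
  rw [hF, hG, hFG] at key
  have hN : (0 : ℝ) < Fintype.card (SpinConfig V × SpinConfig V) := by
    exact_mod_cast Fintype.card_pos
  have hZ := part_pos E J
  rw [eq_comm, ← mul_right_inj' hN.ne', ← key]
  unfold clusterWeight
  split_ifs
  · field_simp
  · simp

/-- The cluster form of the switching lemma for double random currents. -/
theorem corr_mul_corr (E : ι → V × V) (J : ι → ℝ) (o : V) (A B : List V) :
    corr E J A * corr E J B = ∑ K : Finset V with o ∈ K,
      (if Even (inPart K B).length then clusterWeight E J K (inPart K (A ++ B)) else 0) *
        corr E (cut E J K) (outPart K A) * corr E (cut E J K) (outPart K B) := by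
  classical
  have hZ := part_pos E J
  have h1 : ∑ σ : SpinConfig V, ∑ τ : SpinConfig V, spinProd A σ * spinProd B τ *
      (weight E J σ * weight E J τ) =
      (corr E J A * part E J) * (corr E J B * part E J) := by
    rw [← sum_eq_corr_mul_part, ← sum_eq_corr_mul_part, Finset.sum_mul_sum]
    exact Finset.sum_congr rfl fun σ _ => Finset.sum_congr rfl fun τ _ => by ring
  have h2 : ∀ σ τ : SpinConfig V, weight E J σ * weight E J τ = ∑ K : Finset V with o ∈ K,
      (∑ ω ∈ connecting E K, ∏ e ∈ ω, mayer E J σ τ e) *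
          ∏ e ∈ outer E K, (1 + mayer E J σ τ e) := fun σ τ => by
    rw [weight_mul_weight, Finset.prod_one_add,
      ← Finset.sum_fiberwise_of_maps_to (s := Finset.univ.powerset) (g := fun ω => cluster E ω o)
        (t := Finset.univ.filter fun K : Finset V => o ∈ K)]
    · refine Finset.sum_congr rfl fun K hK => ?_
      exact sum_prod_cluster_eq E _ (by simpa using hK)
    · intro ω _
      simp [mem_cluster_self]
  have h3 : (corr E J A * corr E J B) * part E J ^ 2 = (∑ K : Finset V with o ∈ K,
      (if Even (inPart K B).length then clusterWeight E J K (inPart K (A ++ B)) else 0) *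
        corr E (cut E J K) (outPart K A) * corr E (cut E J K) (outPart K B)) * part E J ^ 2 := by
    rw [Finset.sum_mul, show corr E J A * corr E J B * part E J ^ 2 =
      (corr E J A * part E J) * (corr E J B * part E J) by ring, ← h1]
    simp only [h2, Finset.mul_sum]
    rw [Finset.sum_congr rfl fun σ _ => Finset.sum_comm, Finset.sum_comm]
    refine Finset.sum_congr rfl fun K hK => ?_
    exact cluster_term E J (by simpa using hK) A B
  exact mul_right_cancel₀ (by positivity) h3

end Switching

/-! ### Correlation identities and inequalities from the cluster expansion -/

section Inequalities

variable {V ι : Type} [Fintype V] [DecidableEq V] [Fintype ι] [DecidableEq ι]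

theorem hasDerivAt_sum_spinProd_weight (E : ι → V × V) {J : ℝ → ι → ℝ} {J' : ι → ℝ} {s : ℝ}
    (h : ∀ e, HasDerivAt (fun s => J s e) (J' e) s) (l : List V) :
    HasDerivAt (fun s => ∑ σ : SpinConfig V, spinProd l σ * weight E (J s) σ)
      (∑ e, J' e * (corr E (J s) (l ++ [(E e).1, (E e).2]) * part E (J s))) s := by
  have h1 : HasDerivAt (fun s => ∑ σ : SpinConfig V, spinProd l σ * weight E (J s) σ)
      (∑ σ : SpinConfig V, spinProd l σ * (weight E (J s) σ * ∑ e, J' e * bond E e σ)) s := by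
    refine HasDerivAt.fun_sum fun σ _ => HasDerivAt.const_mul _ (HasDerivAt.exp ?_)
    exact HasDerivAt.fun_sum fun e _ => (h e).mul_const _
  convert h1 using 1
  simp only [← sum_eq_corr_mul_part, Finset.mul_sum]
  rw [Finset.sum_comm]
  refine Finset.sum_congr rfl fun σ _ => Finset.sum_congr rfl fun e _ => ?_
  simp only [spinProd_append, spinProd_cons, spinProd_nil, bond]
  ring

theorem hasDerivAt_corr (E : ι → V × V) {J : ℝ → ι → ℝ} {J' : ι → ℝ} {s : ℝ}
    (h : ∀ e, HasDerivAt (fun s => J s e) (J' e) s) (l : List V) :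
    HasDerivAt (fun s => corr E (J s) l)
      (∑ e, J' e * (corr E (J s) (l ++ [(E e).1, (E e).2]) -
        corr E (J s) l * corr E (J s) [(E e).1, (E e).2])) s := by
  have h1 := hasDerivAt_sum_spinProd_weight E h l
  have h2 := hasDerivAt_sum_spinProd_weight E h []
  simp only [spinProd_nil, one_mul, List.nil_append] at h2
  have hZ := part_pos E (J s)
  have h3 := h1.div h2 (part_pos E (J s)).ne'
  refine h3.congr_deriv ?_
  change _ / part E (J s) ^ 2 = _
  rw [sum_eq_corr_mul_part]
  change (_ * part E (J s) - _) / _ = _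
  simp only [← mul_assoc, ← Finset.sum_mul, mul_sub, Finset.sum_sub_distrib]
  have h4 : ∑ e, J' e * corr E (J s) l * corr E (J s) [(E e).1, (E e).2] =
      corr E (J s) l * ∑ e, J' e * corr E (J s) [(E e).1, (E e).2] := by
    rw [Finset.mul_sum]
    exact Finset.sum_congr rfl fun e _ => by ring
  rw [h4]
  field_simp

theorem corr_mul_corr_ite (E : ι → V × V) (J : ι → ℝ) (o : V) (A B : List V) :
    corr E J A * corr E J B = ∑ K : Finset V, if o ∈ K then
      (if Even (inPart K B).length then clusterWeight E J K (inPart K (A ++ B)) else 0) *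
        corr E (cut E J K) (outPart K A) * corr E (cut E J K) (outPart K B) else 0 := by
  rw [corr_mul_corr E J o, Finset.sum_filter]

theorem corr_eq_sum_ite (E : ι → V × V) (J : ι → ℝ) (o : V) (A : List V) :
    corr E J A = ∑ K : Finset V, if o ∈ K then
      clusterWeight E J K (inPart K A) * corr E (cut E J K) (outPart K A) else 0 := by
  have := corr_mul_corr_ite E J o A []
  simpa [inPart, outPart] using this

@[simp] theorem clusterWeight_one (E : ι → V × V) (J : ι → ℝ) (K : Finset V) (a : V) :
    clusterWeight E J K [a] = 0 := clusterWeight_odd E J K (by simp)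

@[simp] theorem clusterWeight_three (E : ι → V × V) (J : ι → ℝ) (K : Finset V) (a b c : V) :
    clusterWeight E J K [a, b, c] = 0 :=
  clusterWeight_odd E J K (by simp [Nat.even_iff])

@[simp] theorem clusterWeight_five (E : ι → V × V) (J : ι → ℝ) (K : Finset V) (a b c d e : V) :
    clusterWeight E J K [a, b, c, d, e] = 0 :=
  clusterWeight_odd E J K (by simp [Nat.even_iff])

/-- The weight of the event that four sources lie in a common cluster. -/
noncomputable def joint (E : ι → V × V) (J : ι → ℝ) (o x y z : V) : ℝ :=
  ∑ K : Finset V, if o ∈ K ∧ x ∈ K ∧ y ∈ K ∧ z ∈ K then clusterWeight E J K [o, x, y, z] else 0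

theorem joint_nonneg (E : ι → V × V) {J : ι → ℝ} (hJ : ∀ e, 0 ≤ J e) (o x y z : V) :
    0 ≤ joint E J o x y z :=
  Finset.sum_nonneg fun K _ => by
    split_ifs
    · exact clusterWeight_nonneg E hJ K _
    · exact le_rfl

theorem joint_swap_right (E : ι → V × V) (J : ι → ℝ) (o x y z : V) :
    joint E J o x y z = joint E J o x z y := by
  refine Finset.sum_congr rfl fun K _ => ?_
  rw [clusterWeight_congr E J K (l' := [o, x, z, y]) fun σ => by
      simp only [spinProd_cons, spinProd_nil]; ring]
  exact if_congr (by tauto) rfl rfl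

theorem joint_swap_mid (E : ι → V × V) (J : ι → ℝ) (o x y z : V) :
    joint E J o x y z = joint E J o y x z := by
  refine Finset.sum_congr rfl fun K _ => ?_
  rw [clusterWeight_congr E J K (l' := [o, y, x, z]) fun σ => by
      simp only [spinProd_cons, spinProd_nil]; ring]
  exact if_congr (by tauto) rfl rfl

/-- Expand every term over the cluster of `o`. A cluster with exactly one further source occurs once
on each side; one with all four sources occurs once in the four-point function and in each of the
three products, whence the correction by 2. Other clusters vanish by parity. -/
theorem corr_four (E : ι → V × V) (J : ι → ℝ) (o x y z : V) :
    corr E J [o, x, y, z] = corr E J [o, x] * corr E J [y, z] + corr E J [o, y] * corr E J [x, z] +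
      corr E J [o, z] * corr E J [x, y] - 2 * joint E J o x y z := by
  rw [corr_eq_sum_ite E J o [o, x, y, z], corr_mul_corr_ite E J o [o, x] [y, z],
    corr_mul_corr_ite E J o [o, y] [x, z], corr_mul_corr_ite E J o [o, z] [x, y], joint,
    Finset.mul_sum, ← Finset.sum_add_distrib, ← Finset.sum_add_distrib, ← Finset.sum_sub_distrib]
  refine Finset.sum_congr rfl fun K _ => ?_
  have h1 : clusterWeight E J K [o, y, x, z] = clusterWeight E J K [o, x, y, z] :=
    clusterWeight_congr E J K fun σ => by
      simp only [spinProd_cons, spinProd_nil]; ring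
  have h2 : clusterWeight E J K [o, z, x, y] = clusterWeight E J K [o, x, y, z] :=
    clusterWeight_congr E J K fun σ => by
      simp only [spinProd_cons, spinProd_nil]; ring
  by_cases ho : o ∈ K <;> by_cases hx : x ∈ K <;> by_cases hy : y ∈ K <;> by_cases hz : z ∈ K <;>
    simp [inPart, outPart, ho, hx, hy, hz, h1, h2] <;> ring

theorem joint_le (E : ι → V × V) {J : ι → ℝ} (hJ : ∀ e, 0 ≤ J e) (o x y z : V) :
    joint E J o x y z ≤ corr E J [o, x] * corr E J [y, z] := by
  rw [corr_mul_corr_ite E J o [o, x] [y, z]]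
  refine Finset.sum_le_sum fun K _ => ?_
  have hp := clusterWeight_nonneg E hJ K
  have hc := corr_nonneg E (cut_nonneg E hJ K)
  by_cases ho : o ∈ K <;> by_cases hx : x ∈ K <;> by_cases hy : y ∈ K <;> by_cases hz : z ∈ K <;>
    simp [inPart, outPart, ho, hx, hy, hz, hp, hc, mul_nonneg]

/-- Expand the product of the `o`–`x` and `y`–`z` correlations in two ways: with the second factor
kept intact, or by switching. In the latter, parity leaves only clusters containing all four sites,
which make up `joint`, or `o` and `x` but neither `y` nor `z`. -/
theorem joint_eq (E : ι → V × V) (J : ι → ℝ) (o x y z : V) :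
    joint E J o x y z = ∑ K : Finset V, if o ∈ K ∧ x ∈ K then clusterWeight E J K [o, x] *
      (corr E J [y, z] - if y ∈ K ∨ z ∈ K then 0 else corr E (cut E J K) [y, z]) else 0 := by
  have h1 : corr E J [o, x] * corr E J [y, z] =
      ∑ K : Finset V, if o ∈ K ∧ x ∈ K then clusterWeight E J K [o, x] * corr E J [y, z] else 0 := by
    rw [corr_eq_sum_ite E J o [o, x], Finset.sum_mul]
    refine Finset.sum_congr rfl fun K _ => ?_
    by_cases ho : o ∈ K <;> by_cases hx : x ∈ K <;> simp [inPart, outPart, ho, hx]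
  have h2 := corr_mul_corr_ite E J o [o, x] [y, z]
  rw [h1] at h2
  have h3 : joint E J o x y z = joint E J o x y z + ((∑ K : Finset V, if o ∈ K ∧ x ∈ K then
      clusterWeight E J K [o, x] * corr E J [y, z] else 0) - ∑ K : Finset V, if o ∈ K then
      (if Even (inPart K [y, z]).length then clusterWeight E J K (inPart K ([o, x] ++ [y, z])) else 0) *
        corr E (cut E J K) (outPart K [o, x]) * corr E (cut E J K) (outPart K [y, z]) else 0) := by
    rw [h2]; ring
  rw [h3, joint, ← Finset.sum_sub_distrib, ← Finset.sum_add_distrib]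
  refine Finset.sum_congr rfl fun K _ => ?_
  by_cases ho : o ∈ K <;> by_cases hx : x ∈ K <;> by_cases hy : y ∈ K <;> by_cases hz : z ∈ K <;>
    simp [inPart, outPart, ho, hx, hy, hz] <;> ring

/-- The weight of the event that the cluster joining `o` and `x` contains `u`. -/
theorem sum_clusterWeight_mem (E : ι → V × V) (J : ι → ℝ) (o x u : V) :
    ∑ K : Finset V, (if o ∈ K ∧ x ∈ K ∧ u ∈ K then clusterWeight E J K [o, x] else 0) =
      corr E J [o, u] * corr E J [u, x] := by
  -- Parity of `[u, x]` puts `u` and `x` both inside or both outside K; outside, `o` would be a lone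
  -- source. Inside, the doubled source `u` cancels.
  rw [corr_mul_corr_ite E J o [o, u] [u, x]]
  refine Finset.sum_congr rfl fun K _ => ?_
  have h1 : clusterWeight E J K [o, u, u, x] = clusterWeight E J K [o, x] :=
    clusterWeight_congr E J K fun σ => by
      simp only [spinProd_cons, spinProd_nil]; linear_combination spin σ o * spin σ x * spin_mul_self σ u
  by_cases ho : o ∈ K <;> by_cases hx : x ∈ K <;> by_cases hu : u ∈ K <;>
    simp [inPart, outPart, ho, hx, hu, h1]

theorem sum_clusterWeight_pair (E : ι → V × V) (J : ι → ℝ) (o x : V) :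
    ∑ K : Finset V, (if o ∈ K ∧ x ∈ K then clusterWeight E J K [o, x] else 0) =
      corr E J [o, x] := by
  have := sum_clusterWeight_mem E J o x x
  simpa [corr_pair_self] using this

theorem sum_clusterWeight_nil (E : ι → V × V) (J : ι → ℝ) (v : V) :
    ∑ K : Finset V, (if v ∈ K then clusterWeight E J K [] else 0) = 1 := by
  have := corr_eq_sum_ite E J v []
  rw [corr_nil] at this
  simpa [inPart, outPart] using this.symm

/-- Decoupling a site `v` from a two-point function. -/
theorem sum_clusterWeight_nil_mul (E : ι → V × V) (J : ι → ℝ) (v x y : V) :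
    ∑ K : Finset V, (if v ∈ K then clusterWeight E J K [] *
      (corr E J [x, y] - if x ∈ K ∨ y ∈ K then 0 else corr E (cut E J K) [x, y]) else 0) =
      corr E J [x, v] * corr E J [v, y] := by
  have h1 : corr E J [x, y] = ∑ K : Finset V, if v ∈ K then
      clusterWeight E J K [] * corr E J [x, y] else 0 := by
    have := congrArg (· * corr E J [x, y]) (sum_clusterWeight_nil E J v)
    simp only [one_mul, Finset.sum_mul, ite_mul, zero_mul] at this
    exact this.symm
  have h2 := corr_eq_sum_ite E J v [x, y]
  -- A zero is inserted as p - p so that its two copies can be expanded differently.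
  have h3 : corr E J [x, v] * corr E J [v, y] =
      corr E J [x, v] * corr E J [v, y] + (corr E J [x, y] - corr E J [x, y]) := by ring
  rw [h3]
  nth_rewrite 2 [h1]
  rw [h2, ← sum_clusterWeight_mem, ← Finset.sum_sub_distrib, ← Finset.sum_add_distrib]
  refine Finset.sum_congr rfl fun K _ => ?_
  rw [← h2]
  by_cases hv : v ∈ K <;> by_cases hx : x ∈ K <;> by_cases hy : y ∈ K <;>
    simp [inPart, outPart, hv, hx, hy] <;> ring

theorem corr_cut_nonneg (E : ι → V × V) {J : ι → ℝ} (hJ : ∀ e, 0 ≤ J e) (K : Finset V)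
    (l : List V) : 0 ≤ corr E (cut E J K) l := corr_nonneg E (cut_nonneg E hJ K) l

/-- The truncated correlation of a pair of sites and a bond. -/
noncomputable def truncated (E : ι → V × V) (J : ι → ℝ) (y z u v : V) : ℝ :=
  corr E J [y, z, u, v] - corr E J [y, z] * corr E J [u, v]

/-- By `corr_four` this is a sum of two pairings minus `2 * joint`, and `joint` is at most either
pairing. -/
theorem truncated_nonneg (E : ι → V × V) {J : ι → ℝ} (hJ : ∀ e, 0 ≤ J e) (y z u v : V) :
    0 ≤ truncated E J y z u v := by
  have h := corr_four E J y z u v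
  have h1 := joint_le E hJ y u z v
  have h2 := joint_le E hJ y v z u
  rw [joint_swap_mid] at h1
  rw [joint_swap_mid, joint_swap_right] at h2
  rw [truncated]
  linarith

/-- Griffiths' second inequality for pairs, as monotonicity in the couplings. -/
theorem corr_pair_mono (E : ι → V × V) {J J' : ι → ℝ} (hJ : ∀ e, 0 ≤ J e) (h : ∀ e, J e ≤ J' e)
    (x y : V) : corr E J [x, y] ≤ corr E J' [x, y] := by
  have hd : ∀ s : ℝ, ∀ e, HasDerivAt (fun s : ℝ => J e + s * (J' e - J e)) (J' e - J e) s :=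
    fun s e => by simpa using ((hasDerivAt_id s).mul_const (J' e - J e)).const_add (J e)
  have hderiv := fun s : ℝ =>
    hasDerivAt_corr E (J := fun s e => J e + s * (J' e - J e)) (hd s) [x, y]
  -- Along the segment from `J` to `J'` the derivative is a nonnegative combination of truncated
  -- correlations.
  have hmono : MonotoneOn (fun s : ℝ => corr E (fun e => J e + s * (J' e - J e)) [x, y])
      (Set.Icc 0 1) := by
    refine monotoneOn_of_deriv_nonneg (convex_Icc 0 1)
      (fun s _ => (hderiv s).continuousAt.continuousWithinAt)
      (fun s _ => (hderiv s).differentiableAt.differentiableWithinAt) fun s hs => ?_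
    rw [interior_Icc] at hs
    rw [(hderiv s).deriv]
    refine Finset.sum_nonneg fun e _ => mul_nonneg (by linarith [h e]) ?_
    exact truncated_nonneg E
      (fun e => add_nonneg (hJ e) (mul_nonneg hs.1.le (by linarith [h e]))) x y _ _
  have := hmono (Set.left_mem_Icc.2 zero_le_one) (Set.right_mem_Icc.2 zero_le_one) zero_le_one
  simpa using this

/-- The tree bound for the event that the cluster joining `o` and `x` contains `u` and `v`. -/
theorem sum_clusterWeight_mem_mem_le (E : ι → V × V) {J : ι → ℝ} (hJ : ∀ e, 0 ≤ J e)
    (o x u v : V) :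
    ∑ K : Finset V, (if o ∈ K ∧ x ∈ K ∧ u ∈ K ∧ v ∈ K then clusterWeight E J K [o, x] else 0) ≤
      corr E J [o, u] * corr E J [u, v] * corr E J [v, x] +
        corr E J [o, v] * corr E J [v, u] * corr E J [u, x] := by
  -- The same product is explored from `v`: the cluster contains all of `o`, `u`, `x`, which gives
  -- the left-hand side, or none of them. The left-hand side is thus the mean over the cluster of
  -- `v` of AB minus ab on the second event, where A, B are the two correlations and a, b their cut
  -- versions.
  have h0 := corr_mul_corr_ite E J v [o, u] [u, x]
  have h1 : corr E J [o, u] * corr E J [u, x] = ∑ K : Finset V, if v ∈ K then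
      clusterWeight E J K [] * (corr E J [o, u] * corr E J [u, x]) else 0 := by
    have := congrArg (· * (corr E J [o, u] * corr E J [u, x])) (sum_clusterWeight_nil E J v)
    simp only [one_mul, Finset.sum_mul, ite_mul, zero_mul] at this
    exact this.symm
  have h2 := congrArg (corr E J [o, u] * ·) (sum_clusterWeight_nil_mul E J v u x)
  have h3 := congrArg (corr E J [u, x] * ·) (sum_clusterWeight_nil_mul E J v o u)
  simp only [Finset.mul_sum] at h2 h3
  have h4 : corr E J [o, u] * corr E J [u, v] * corr E J [v, x] +
        corr E J [o, v] * corr E J [v, u] * corr E J [u, x] =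
      corr E J [o, u] * (corr E J [u, v] * corr E J [v, x]) +
        corr E J [u, x] * (corr E J [o, v] * corr E J [v, u]) +
        (corr E J [o, u] * corr E J [u, x] - corr E J [o, u] * corr E J [u, x]) := by ring
  rw [h4, ← h2, ← h3]
  nth_rewrite 2 [h1]
  rw [h0, ← Finset.sum_sub_distrib, ← Finset.sum_add_distrib, ← Finset.sum_add_distrib]
  rw [← h0]
  refine Finset.sum_le_sum fun K _ => ?_
  have hp := clusterWeight_nonneg E hJ K []
  have hA := corr_nonneg E hJ [o, u]
  have hB := corr_nonneg E hJ [u, x]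
  have ha := corr_cut_nonneg E hJ K [o, u]
  have hb := corr_cut_nonneg E hJ K [u, x]
  have haA := corr_pair_mono E (cut_nonneg E hJ K) (cut_le E hJ K) o u
  have hbB := corr_pair_mono E (cut_nonneg E hJ K) (cut_le E hJ K) u x
  -- This is AB - ab ≤ A(B - b) + B(A - a); each term on the right is evaluated by
  -- `sum_clusterWeight_nil_mul`.
  have hq := mul_nonneg hp (mul_nonneg (sub_nonneg.2 haA) (sub_nonneg.2 hbB))
  have hpp := mul_nonneg hp (mul_nonneg hA hB)
  have hpp1 := mul_nonneg hp (mul_nonneg hA (sub_nonneg.2 hbB))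
  have hpp2 := mul_nonneg hp (mul_nonneg hB (sub_nonneg.2 haA))
  have h1 : clusterWeight E J K [o, u, u, x] = clusterWeight E J K [o, x] :=
    clusterWeight_congr E J K fun σ => by
      simp only [spinProd_cons, spinProd_nil]; linear_combination spin σ o * spin σ x * spin_mul_self σ u
  by_cases hv : v ∈ K <;> by_cases ho : o ∈ K <;> by_cases hx : x ∈ K <;> by_cases hu : u ∈ K <;>
    simp [inPart, outPart, ho, hx, hu, hv, h1] <;> linarith

end Inequalities

/-! ### Third cumulants of a pair of sites and two bonds -/

section ThirdOrder

variable {V ι : Type} [Fintype V] [DecidableEq V] [Fintype ι] [DecidableEq ι]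

/-- The two expansions over the cluster of `y` differ only where exactly one of `u`, `v` lies in it;
parity then keeps `z` outside. -/
theorem truncated_eq_sum (E : ι → V × V) (J : ι → ℝ) (y z u v : V) :
    truncated E J y z u v = ∑ K : Finset V, if y ∈ K ∧ z ∉ K then
      (if u ∈ K ∧ v ∉ K then clusterWeight E J K [y, u] * corr E (cut E J K) [z, v] else 0) +
      (if v ∈ K ∧ u ∉ K then clusterWeight E J K [y, v] * corr E (cut E J K) [z, u] else 0)
      else 0 := by
  rw [truncated, corr_eq_sum_ite E J y [y, z, u, v], corr_mul_corr_ite E J y [y, z] [u, v],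
    ← Finset.sum_sub_distrib]
  refine Finset.sum_congr rfl fun K _ => ?_
  by_cases hy : y ∈ K <;> by_cases hz : z ∈ K <;> by_cases hu : u ∈ K <;> by_cases hv : v ∈ K <;>
    simp [inPart, outPart, hy, hz, hu, hv]

/-- The third cumulant of a pair of sites and two bonds. -/
noncomputable def cumulant (E : ι → V × V) (J : ι → ℝ) (y z u v u' v' : V) : ℝ :=
  corr E J [y, z, u, v, u', v'] - corr E J [y, z] * corr E J [u, v, u', v'] -
    corr E J [u, v] * truncated E J y z u' v' - corr E J [u', v'] * truncated E J y z u v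

/-- Lebowitz' inequality in the cut model. The factor on `[a, b]` is left cut so that it cancels
exactly against a subtracted term in `cumulant_le`; the others are raised to `J`. -/
theorem corr_cut_four_le (E : ι → V × V) {J : ι → ℝ} (hJ : ∀ e, 0 ≤ J e) (K : Finset V)
    (a b c d : V) :
    corr E (cut E J K) [a, b, c, d] ≤ corr E (cut E J K) [a, b] * corr E J [c, d] +
      (corr E J [b, c] * corr E J [a, d] + corr E J [b, d] * corr E J [a, c]) := by
  have h := corr_four E (cut E J K) a b c d
  have h1 := joint_nonneg E (cut_nonneg E hJ K) a b c d
  have hm := fun x y => corr_pair_mono E (cut_nonneg E hJ K) (cut_le E hJ K) x y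
  have hn := fun x y => corr_cut_nonneg E hJ K [x, y]
  have hn' := fun x y => corr_nonneg E hJ [x, y]
  have e1 := mul_le_mul_of_nonneg_left (hm c d) (hn a b)
  have e2 := mul_le_mul (hm b c) (hm a d) (hn a d) (hn' b c)
  have e3 := mul_le_mul (hm b d) (hm a c) (hn a c) (hn' b d)
  linarith

/-- Everything is compared cluster by cluster. Clusters of `y` with one bond end give the four
pairing terms, after the disconnected part has cancelled against the bond mean times a truncated
correlation; clusters with three bond ends give the `joint` terms. -/
theorem cumulant_le (E : ι → V × V) {J : ι → ℝ} (hJ : ∀ e, 0 ≤ J e) (y z u v u' v' : V) :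
    cumulant E J y z u v u' v' ≤
      corr E J [y, u] * (corr E J [v, u'] * corr E J [z, v'] + corr E J [v, v'] * corr E J [z, u']) +
      corr E J [y, v] * (corr E J [u, u'] * corr E J [z, v'] + corr E J [u, v'] * corr E J [z, u']) +
      corr E J [y, u'] * (corr E J [v', u] * corr E J [z, v] + corr E J [v', v] * corr E J [z, u]) +
      corr E J [y, v'] * (corr E J [u', u] * corr E J [z, v] + corr E J [u', v] * corr E J [z, u]) +
      joint E J y u v u' * corr E J [z, v'] + joint E J y u v v' * corr E J [z, u'] +
      joint E J y u u' v' * corr E J [z, v] + joint E J y v u' v' * corr E J [z, u] := by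
  rw [cumulant, truncated_eq_sum, truncated_eq_sum, corr_mul_corr_ite E J y [y, z] [u, v, u', v'],
    corr_eq_sum_ite E J y [y, z, u, v, u', v'], ← sum_clusterWeight_pair E J y u,
    ← sum_clusterWeight_pair E J y v, ← sum_clusterWeight_pair E J y u',
    ← sum_clusterWeight_pair E J y v']
  simp only [joint, Finset.sum_mul, Finset.mul_sum]
  simp only [← Finset.sum_add_distrib, ← Finset.sum_sub_distrib]
  refine Finset.sum_le_sum fun K _ => ?_
  have hG := fun a b => corr_nonneg E hJ [a, b]
  have hK := fun a b => corr_cut_nonneg E hJ K [a, b]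
  have hp := clusterWeight_nonneg E hJ K
  have hm := fun x y => corr_pair_mono E (cut_nonneg E hJ K) (cut_le E hJ K) x y
  have m1 := mul_le_mul_of_nonneg_left (corr_cut_four_le E hJ K z v u' v') (hp [y, u])
  have m2 := mul_le_mul_of_nonneg_left (corr_cut_four_le E hJ K z u u' v') (hp [y, v])
  have m3 := mul_le_mul_of_nonneg_left (corr_cut_four_le E hJ K z v' u v) (hp [y, u'])
  have m4 := mul_le_mul_of_nonneg_left (corr_cut_four_le E hJ K z u' u v) (hp [y, v'])
  have c3 : corr E (cut E J K) [z, v', u, v] = corr E (cut E J K) [z, u, v, v'] :=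
    corr_congr _ _ fun σ => by simp only [spinProd_cons, spinProd_nil]; ring
  have c4 : corr E (cut E J K) [z, u', u, v] = corr E (cut E J K) [z, u, v, u'] :=
    corr_congr _ _ fun σ => by simp only [spinProd_cons, spinProd_nil]; ring
  rw [c3] at m3
  rw [c4] at m4
  have n1 := mul_le_mul_of_nonneg_left (hm z v') (hp [y, u, v, u'])
  have n2 := mul_le_mul_of_nonneg_left (hm z u') (hp [y, u, v, v'])
  have n3 := mul_le_mul_of_nonneg_left (hm z v) (hp [y, u, u', v'])
  have n4 := mul_le_mul_of_nonneg_left (hm z u) (hp [y, v, u', v'])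
  have q1 := mul_nonneg (hp [y, u]) (add_nonneg (mul_nonneg (hG v u') (hG z v'))
    (mul_nonneg (hG v v') (hG z u')))
  have q2 := mul_nonneg (hp [y, v]) (add_nonneg (mul_nonneg (hG u u') (hG z v'))
    (mul_nonneg (hG u v') (hG z u')))
  have q3 := mul_nonneg (hp [y, u']) (add_nonneg (mul_nonneg (hG v' u) (hG z v))
    (mul_nonneg (hG v' v) (hG z u)))
  have q4 := mul_nonneg (hp [y, v']) (add_nonneg (mul_nonneg (hG u' u) (hG z v))
    (mul_nonneg (hG u' v) (hG z u)))
  have j1 := mul_nonneg (hp [y, u, v, u']) (hG z v')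
  have j2 := mul_nonneg (hp [y, u, v, v']) (hG z u')
  have j3 := mul_nonneg (hp [y, u, u', v']) (hG z v)
  have j4 := mul_nonneg (hp [y, v, u', v']) (hG z u)
  have t1 := mul_nonneg (hG u' v') (mul_nonneg (hp [y, u]) (hK z v))
  have t2 := mul_nonneg (hG u' v') (mul_nonneg (hp [y, v]) (hK z u))
  have t3 := mul_nonneg (hG u v) (mul_nonneg (hp [y, u']) (hK z v'))
  have t4 := mul_nonneg (hG u v) (mul_nonneg (hp [y, v']) (hK z u'))
  by_cases hy : y ∈ K
  · by_cases hz : z ∈ K <;> by_cases hu : u ∈ K <;> by_cases hv : v ∈ K <;>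
      by_cases hu' : u' ∈ K <;> by_cases hv' : v' ∈ K <;>
      simp [inPart, outPart, hy, hz, hu, hv, hu', hv', Nat.even_iff] <;> linarith
  · simp [hy]

theorem sum_sum_mul_mul {G : V → V → ℝ} {χ : ℝ} (hχ : ∀ u, ∑ y, G y u = χ) (a b : V) (c : ℝ) :
    ∑ y, ∑ z, G y a * (c * G z b) = χ ^ 2 * c := by
  simp only [← Finset.mul_sum, hχ, ← Finset.sum_mul]
  ring

/-- The sum of the two-point functions between the ends of two bonds. -/
noncomputable def bondSum (E : ι → V × V) (J : ι → ℝ) (e e' : ι) : ℝ :=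
  corr E J [(E e).1, (E e').1] + corr E J [(E e).1, (E e').2] +
    corr E J [(E e).2, (E e').1] + corr E J [(E e).2, (E e').2]

theorem bondSum_nonneg (E : ι → V × V) {J : ι → ℝ} (hJ : ∀ e, 0 ≤ J e) (e e' : ι) :
    0 ≤ bondSum E J e e' := by
  have := fun a b => corr_nonneg E hJ [a, b]
  unfold bondSum
  linarith [this (E e).1 (E e').1, this (E e).1 (E e').2, this (E e).2 (E e').1,
    this (E e).2 (E e').2]

theorem bondSum_comm (E : ι → V × V) (J : ι → ℝ) (e e' : ι) :
    bondSum E J e e' = bondSum E J e' e := by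
  simp only [bondSum, corr_pair_comm E J (E e).1, corr_pair_comm E J (E e).2]
  ring

/-- Summed bound on the third cumulants, for couplings below `J`. -/
theorem sum_cumulant_le (E : ι → V × V) {J J₀ : ι → ℝ} (hJ : ∀ e, 0 ≤ J e)
    (hJJ : ∀ e, J e ≤ J₀ e) {χ : ℝ} (hχ : ∀ u, ∑ y, corr E J₀ [y, u] = χ) (e e' : ι) :
    ∑ y, ∑ z, cumulant E J y z (E e).1 (E e).2 (E e').1 (E e').2 ≤
      3 * χ ^ 2 * bondSum E J₀ e e' := by
  rcases hE : E e with ⟨u, v⟩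
  rcases hE' : E e' with ⟨u', v'⟩
  let G : V → V → ℝ := fun a b => corr E J₀ [a, b]
  have hm : ∀ a b, corr E J [a, b] ≤ G a b := fun a b => corr_pair_mono E hJ hJJ a b
  have hn : ∀ a b, 0 ≤ corr E J [a, b] := fun a b => corr_nonneg E hJ [a, b]
  have hG : ∀ a b, 0 ≤ G a b := fun a b => (hn a b).trans (hm a b)
  have hsymm : ∀ a b, G a b = G b a := fun a b => corr_pair_comm E J₀ a b
  have hc : ∀ a b c d f g, corr E J [a, b] * (corr E J [c, d] * corr E J [f, g]) ≤
      G a b * (G c d * G f g) := fun a b c d f g =>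
    mul_le_mul (hm a b) (mul_le_mul (hm c d) (hm f g) (hn f g) (hG c d))
      (mul_nonneg (hn c d) (hn f g)) (hG a b)
  have hj : ∀ y z a b c d, joint E J y a b c * corr E J [z, d] ≤ G y a * (G b c * G z d) :=
    fun y z a b c d => by
      refine (mul_le_mul_of_nonneg_right (joint_le E hJ y a b c) (hn z d)).trans ?_
      rw [mul_assoc]
      exact hc _ _ _ _ _ _
  have hpt : ∀ y z, cumulant E J y z u v u' v' ≤
      G y u * (G v u' * G z v') + G y u * (G v v' * G z u') +
      G y v * (G u u' * G z v') + G y v * (G u v' * G z u') +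
      G y u' * (G u v' * G z v) + G y u' * (G v v' * G z u) +
      G y v' * (G u u' * G z v) + G y v' * (G v u' * G z u) +
      G y u * (G v u' * G z v') + G y v * (G u v' * G z u') +
      G y v' * (G u u' * G z v) + G y u' * (G v v' * G z u) := fun y z => by
    have h := cumulant_le E hJ y z u v u' v'
    -- Sources are permuted so that `joint_le` attaches `y` and `z` to different bonds, the
    -- remaining factor joining the other two ends.
    have s2 : joint E J y u v v' = joint E J y v u v' := joint_swap_mid _ _ _ _ _ _
    have s3 : joint E J y u u' v' = joint E J y v' u u' := by
      rw [joint_swap_right, joint_swap_mid]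
    have s4 : joint E J y v u' v' = joint E J y u' v v' := joint_swap_mid _ _ _ _ _ _
    rw [s2, s3, s4] at h
    have := hc y u v u' z v'
    have := hc y u v v' z u'
    have := hc y v u u' z v'
    have := hc y v u v' z u'
    have h5 := hc y u' v' u z v
    have h6 := hc y u' v' v z u
    have h7 := hc y v' u' u z v
    have h8 := hc y v' u' v z u
    rw [hsymm v' u] at h5
    rw [hsymm v' v] at h6
    rw [hsymm u' u] at h7
    rw [hsymm u' v] at h8
    have := hj y z u v u' v'
    have := hj y z v u v' u'
    have := hj y z v' u u' v
    have := hj y z u' v v' u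
    linarith
  refine (Finset.sum_le_sum fun y _ => Finset.sum_le_sum fun z _ => hpt y z).trans ?_
  -- Each of the four pairs of ends in `bondSum` occurs in three of the twelve terms, whence the
  -- factor 3.
  simp only [Finset.sum_add_distrib, sum_sum_mul_mul (G := G) hχ]
  apply le_of_eq
  simp only [bondSum, hE, hE', G]
  ring

end ThirdOrder

/-! ### Second-order Taylor bound from a one-sided bound on the second derivative -/

theorem le_taylor_two {f f₁ f₂ : ℝ → ℝ} {C t : ℝ} (ht : 0 ≤ t)
    (hf : ∀ s, HasDerivAt f (f₁ s) s) (hf₁ : ∀ s, HasDerivAt f₁ (f₂ s) s)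
    (hC : ∀ s ∈ Set.Ioo 0 t, f₂ s ≤ C) : f t ≤ f 0 + t * f₁ 0 + C * t ^ 2 / 2 := by
  have h1 : ∀ s ∈ Set.Icc 0 t, f₁ s ≤ f₁ 0 + C * s := by
    have hd : ∀ s, HasDerivAt (fun s => f₁ s - C * s) (f₂ s - C) s := fun s =>
      ((hf₁ s).sub ((hasDerivAt_id s).const_mul C)).congr_deriv (by simp)
    have hanti : AntitoneOn (fun s => f₁ s - C * s) (Set.Icc 0 t) := by
      refine antitoneOn_of_deriv_nonpos (convex_Icc 0 t)
        (fun s _ => (hd s).continuousAt.continuousWithinAt)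
        (fun s _ => (hd s).differentiableAt.differentiableWithinAt) fun s hs => ?_
      rw [interior_Icc] at hs
      rw [(hd s).deriv]
      linarith [hC s hs]
    intro s hs
    have := hanti (Set.left_mem_Icc.2 ht) hs hs.1
    simp only [mul_zero, sub_zero] at this
    linarith
  have hd : ∀ s, HasDerivAt (fun s => f s - s * f₁ 0 - C * s ^ 2 / 2) (f₁ s - f₁ 0 - C * s) s :=
    fun s => by
      have h := ((hf s).sub ((hasDerivAt_id s).mul_const (f₁ 0))).sub
        ((((hasDerivAt_id s).pow 2).const_mul C).div_const 2)
      refine h.congr_deriv ?_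
      simp
      ring
  have hanti : AntitoneOn (fun s => f s - s * f₁ 0 - C * s ^ 2 / 2) (Set.Icc 0 t) := by
    refine antitoneOn_of_deriv_nonpos (convex_Icc 0 t)
      (fun s _ => (hd s).continuousAt.continuousWithinAt)
      (fun s _ => (hd s).differentiableAt.differentiableWithinAt) fun s hs => ?_
    rw [interior_Icc] at hs
    rw [(hd s).deriv]
    linarith [h1 s ⟨hs.1.le, hs.2.le⟩]
  have := hanti (Set.left_mem_Icc.2 ht) (Set.right_mem_Icc.2 ht) ht
  simp only [zero_mul, sub_zero] at this
  norm_num at this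
  linarith

/-! ### Loss of two-point function when a cluster is removed -/

section Deficit

variable {V ι : Type} [Fintype V] [DecidableEq V] [Fintype ι] [DecidableEq ι]

theorem hasDerivAt_truncated (E : ι → V × V) {J : ℝ → ι → ℝ} {J' : ι → ℝ} {s : ℝ}
    (h : ∀ e, HasDerivAt (fun s => J s e) (J' e) s) (y z u v : V) :
    HasDerivAt (fun s => truncated E (J s) y z u v)
      (∑ e, J' e * cumulant E (J s) y z u v (E e).1 (E e).2) s := by
  have h3 := (hasDerivAt_corr E h [y, z, u, v]).sub
    ((hasDerivAt_corr E h [y, z]).mul (hasDerivAt_corr E h [u, v]))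
  refine h3.congr_deriv ?_
  rw [Finset.sum_mul, Finset.mul_sum, ← Finset.sum_add_distrib, ← Finset.sum_sub_distrib]
  refine Finset.sum_congr rfl fun e _ => ?_
  simp only [cumulant, truncated, List.cons_append, List.nil_append]
  ring

/-- The indicator of the edges touching `K`. -/
def touch (E : ι → V × V) (K : Finset V) (e : ι) : ℝ := if e ∈ outer E K then 0 else 1

theorem touch_nonneg (E : ι → V × V) (K : Finset V) (e : ι) : 0 ≤ touch E K e := by
  unfold touch; split_ifs <;> simp

theorem touch_le_one (E : ι → V × V) (K : Finset V) (e : ι) : touch E K e ≤ 1 := by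
  unfold touch; split_ifs <;> simp

/-- Lower bound on the loss of two-point functions when a set of sites is cut out. -/
theorem sum_corr_sub_corr_cut_ge (E : ι → V × V) {β : ℝ} (hβ : 0 ≤ β) (K : Finset V) {χ : ℝ}
    (hχ : ∀ u, ∑ y, corr E (fun _ => β) [y, u] = χ) {t : ℝ} (ht : t ∈ Set.Icc (0 : ℝ) 1) :
    t * (β * ∑ e, touch E K e * ∑ y, ∑ z, truncated E (fun _ => β) y z (E e).1 (E e).2) -
      t ^ 2 / 2 * (β ^ 2 * (3 * χ ^ 2) *
        ∑ e, ∑ e', touch E K e * touch E K e' * bondSum E (fun _ => β) e e') ≤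
      ∑ y, ∑ z, (corr E (fun _ => β) [y, z] - corr E (cut E (fun _ => β) K) [y, z]) := by
  -- At s = 1 this is the cut model. Stopping at an arbitrary t leaves a parameter with which to
  -- balance the two Taylor terms.
  let J : ℝ → ι → ℝ := fun s e => β * (1 - s * touch E K e)
  let J' : ι → ℝ := fun e => -(β * touch E K e)
  have hJ : ∀ s e, HasDerivAt (fun s => J s e) (J' e) s := fun s e => by
    have := ((((hasDerivAt_id s).mul_const (touch E K e)).const_sub 1).const_mul β)
    refine this.congr_deriv ?_
    simp [J']
  have hJ0 : J 0 = fun _ => β := by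
    ext e; simp [J]
  have hJnn : ∀ s ∈ Set.Icc (0 : ℝ) 1, ∀ e, 0 ≤ J s e := fun s hs e => by
    have := mul_le_mul hs.2 (touch_le_one E K e) (touch_nonneg E K e) zero_le_one
    exact mul_nonneg hβ (by linarith)
  have hJle : ∀ s ∈ Set.Icc (0 : ℝ) 1, ∀ e, J s e ≤ β := fun s hs e => by
    have := mul_nonneg hs.1 (touch_nonneg E K e)
    exact mul_le_of_le_one_right hβ (by linarith)
  have hf : ∀ s, HasDerivAt (fun s => ∑ y, ∑ z, corr E (J s) [y, z])
      (∑ y, ∑ z, ∑ e, J' e * truncated E (J s) y z (E e).1 (E e).2) s := fun s =>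
    HasDerivAt.fun_sum fun y _ => HasDerivAt.fun_sum fun z _ =>
      hasDerivAt_corr E (fun e => hJ s e) [y, z]
  have hf₁ : ∀ s, HasDerivAt (fun s => ∑ y, ∑ z, ∑ e, J' e * truncated E (J s) y z (E e).1 (E e).2)
      (∑ y, ∑ z, ∑ e, J' e * ∑ e', J' e' *
        cumulant E (J s) y z (E e).1 (E e).2 (E e').1 (E e').2) s := fun s =>
    HasDerivAt.fun_sum fun y _ => HasDerivAt.fun_sum fun z _ => HasDerivAt.fun_sum fun e _ =>
      (hasDerivAt_truncated E (fun e => hJ s e) y z _ _).const_mul _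
  have hC : ∀ s ∈ Set.Ioo 0 t, ∑ y, ∑ z, ∑ e, J' e * ∑ e', J' e' *
        cumulant E (J s) y z (E e).1 (E e).2 (E e').1 (E e').2 ≤ β ^ 2 * (3 * χ ^ 2) *
        ∑ e, ∑ e', touch E K e * touch E K e' * bondSum E (fun _ => β) e e' := fun s hs => by
    have hs' : s ∈ Set.Icc (0 : ℝ) 1 := ⟨hs.1.le, hs.2.le.trans ht.2⟩
    have h1 : ∑ y, ∑ z, ∑ e, J' e * ∑ e', J' e' *
        cumulant E (J s) y z (E e).1 (E e).2 (E e').1 (E e').2 =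
        ∑ e, ∑ e', β ^ 2 * (touch E K e * touch E K e') *
          ∑ y, ∑ z, cumulant E (J s) y z (E e).1 (E e).2 (E e').1 (E e').2 := by
      simp only [Finset.mul_sum]
      rw [Finset.sum_congr rfl fun y _ => Finset.sum_comm, Finset.sum_comm]
      refine Finset.sum_congr rfl fun e _ => ?_
      rw [Finset.sum_congr rfl fun y _ => Finset.sum_comm, Finset.sum_comm]
      refine Finset.sum_congr rfl fun e' _ => Finset.sum_congr rfl fun y _ =>
        Finset.sum_congr rfl fun z _ => ?_
      simp only [J']
      ring
    rw [h1]
    simp only [Finset.mul_sum]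
    refine Finset.sum_le_sum fun e _ => Finset.sum_le_sum fun e' _ => ?_
    have h2 := mul_le_mul_of_nonneg_left
      (sum_cumulant_le E (hJnn s hs') (J₀ := fun _ => β) (hJle s hs') hχ e e')
      (mul_nonneg (sq_nonneg β) (mul_nonneg (touch_nonneg E K e) (touch_nonneg E K e')))
    simp only [Finset.mul_sum] at h2
    linarith
  have hT := le_taylor_two ht.1 hf hf₁ hC
  simp only [hJ0] at hT
  have hcut : ∑ y, ∑ z, corr E (cut E (fun _ => β) K) [y, z] ≤ ∑ y, ∑ z, corr E (J t) [y, z] := by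
    refine Finset.sum_le_sum fun y _ => Finset.sum_le_sum fun z _ => ?_
    refine corr_pair_mono E (cut_nonneg E (fun _ => hβ) K) (fun e => ?_) y z
    unfold cut
    split_ifs with h
    · simp [J, touch, h]
    · exact hJnn t ht e
  have h4 : ∑ y, ∑ z, ∑ e, J' e * truncated E (fun _ => β) y z (E e).1 (E e).2 =
      -(β * ∑ e, touch E K e * ∑ y, ∑ z, truncated E (fun _ => β) y z (E e).1 (E e).2) := by
    simp only [Finset.mul_sum, ← Finset.sum_neg_distrib]
    rw [Finset.sum_congr rfl fun y _ => Finset.sum_comm, Finset.sum_comm]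
    refine Finset.sum_congr rfl fun e _ => Finset.sum_congr rfl fun y _ =>
      Finset.sum_congr rfl fun z _ => ?_
    simp only [J']
    ring
  rw [h4] at hT
  simp only [Finset.sum_sub_distrib]
  linarith

/-- The end of a half-edge. -/
def foot (E : ι → V × V) (h : ι × Bool) : V := if h.2 then (E h.1).1 else (E h.1).2

/-- An edge touches K when one of its ends lies in K. Passing to half-edges turns this into
single-site membership, whose moments are known; the first-order term loses the factor 2 of
`sum_foot_le_touch`. -/
theorem touch_le_sum_foot (E : ι → V × V) (K : Finset V) (e : ι) :
    touch E K e ≤ ∑ b : Bool, if foot E (e, b) ∈ K then (1 : ℝ) else 0 := by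
  rw [Fintype.sum_bool]
  by_cases h1 : (E e).1 ∈ K <;> by_cases h2 : (E e).2 ∈ K <;>
    simp [touch, outer, foot, h1, h2]

theorem sum_foot_le_touch (E : ι → V × V) (K : Finset V) (e : ι) :
    ∑ b : Bool, (if foot E (e, b) ∈ K then (1 : ℝ) else 0) ≤ 2 * touch E K e := by
  rw [Fintype.sum_bool]
  by_cases h1 : (E e).1 ∈ K <;> by_cases h2 : (E e).2 ∈ K <;>
    simp [touch, outer, foot, h1, h2] <;> norm_num

/-- Lower bound on the loss of two-point functions, as a sum over half-edges. -/
theorem sum_corr_sub_corr_cut_ge_foot (E : ι → V × V) {β : ℝ} (hβ : 0 ≤ β) (K : Finset V) {χ : ℝ}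
    (hχ : ∀ u, ∑ y, corr E (fun _ => β) [y, u] = χ) {t : ℝ} (ht : t ∈ Set.Icc (0 : ℝ) 1) :
    t * β / 2 * (∑ h : ι × Bool, (if foot E h ∈ K then (1 : ℝ) else 0) *
        ∑ y, ∑ z, truncated E (fun _ => β) y z (E h.1).1 (E h.1).2) -
      t ^ 2 * β ^ 2 * (3 * χ ^ 2) / 2 * ∑ h : ι × Bool, ∑ h' : ι × Bool,
        (if foot E h ∈ K ∧ foot E h' ∈ K then (1 : ℝ) else 0) *
          bondSum E (fun _ => β) h.1 h'.1 ≤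
      ∑ y, ∑ z, (corr E (fun _ => β) [y, z] - corr E (cut E (fun _ => β) K) [y, z]) := by
  refine le_trans ?_ (sum_corr_sub_corr_cut_ge E hβ K hχ ht)
  have h1 : ∑ h : ι × Bool, (if foot E h ∈ K then (1 : ℝ) else 0) *
        ∑ y, ∑ z, truncated E (fun _ => β) y z (E h.1).1 (E h.1).2 ≤
      2 * ∑ e, touch E K e * ∑ y, ∑ z, truncated E (fun _ => β) y z (E e).1 (E e).2 := by
    rw [Fintype.sum_prod_type, Finset.mul_sum]
    refine Finset.sum_le_sum fun e _ => ?_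
    dsimp only
    rw [← Finset.sum_mul, ← mul_assoc]
    refine mul_le_mul_of_nonneg_right (sum_foot_le_touch E K e) ?_
    exact Finset.sum_nonneg fun y _ => Finset.sum_nonneg fun z _ =>
      truncated_nonneg E (fun _ => hβ) _ _ _ _
  have h2 : ∑ e, ∑ e', touch E K e * touch E K e' * bondSum E (fun _ => β) e e' ≤
      ∑ h : ι × Bool, ∑ h' : ι × Bool, (if foot E h ∈ K ∧ foot E h' ∈ K then (1 : ℝ) else 0) *
          bondSum E (fun _ => β) h.1 h'.1 := by
    have h3 : ∀ h h' : ι × Bool, (if foot E h ∈ K ∧ foot E h' ∈ K then (1 : ℝ) else 0) =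
        (if foot E h ∈ K then (1 : ℝ) else 0) * (if foot E h' ∈ K then (1 : ℝ) else 0) :=
      fun h h' => by
        by_cases a : foot E h ∈ K <;> by_cases b : foot E h' ∈ K <;> simp [a, b]
    simp only [h3]
    rw [Fintype.sum_prod_type]
    refine Finset.sum_le_sum fun e _ => ?_
    rw [Finset.sum_comm, Fintype.sum_prod_type]
    refine Finset.sum_le_sum fun e' _ => ?_
    simp only [← Finset.sum_mul, ← Finset.mul_sum]
    exact mul_le_mul_of_nonneg_right (mul_le_mul (touch_le_sum_foot E K e)
      (touch_le_sum_foot E K e') (touch_nonneg E K e')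
      ((touch_nonneg E K e).trans (touch_le_sum_foot E K e))) (bondSum_nonneg E (fun _ => hβ) e e')
  have h5 := mul_le_mul_of_nonneg_left h1 (show 0 ≤ t * β / 2 by have := ht.1; positivity)
  have h6 := mul_le_mul_of_nonneg_left h2 (show 0 ≤ t ^ 2 * β ^ 2 * (3 * χ ^ 2) / 2 by positivity)
  linarith

/-- Lower bound on the summed joint cluster weights. -/
theorem sum_joint_ge (E : ι → V × V) {β : ℝ} (hβ : 0 ≤ β) (o : V) {χ Q : ℝ}
    (hχ : ∀ u, ∑ y, corr E (fun _ => β) [y, u] = χ)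
    (hQ : ∀ h : ι × Bool, ∑ h' : ι × Bool, corr E (fun _ => β) [foot E h, foot E h'] *
      bondSum E (fun _ => β) h.1 h'.1 ≤ Q)
    {t : ℝ} (ht : t ∈ Set.Icc (0 : ℝ) 1) :
    t * β / 2 * χ * (∑ h : ι × Bool, corr E (fun _ => β) [o, foot E h] *
        ∑ y, ∑ z, truncated E (fun _ => β) y z (E h.1).1 (E h.1).2) -
      t ^ 2 * β ^ 2 * (3 * χ ^ 2) * χ * Q * ∑ h : ι × Bool, corr E (fun _ => β) [o, foot E h] ≤
      ∑ x, ∑ y, ∑ z, joint E (fun _ => β) o x y z := by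
  let J : ι → ℝ := fun _ => β
  have hJ : ∀ e, 0 ≤ J e := fun _ => hβ
  change t * β / 2 * χ * (∑ h : ι × Bool, corr E J [o, foot E h] *
        ∑ y, ∑ z, truncated E J y z (E h.1).1 (E h.1).2) -
      t ^ 2 * β ^ 2 * (3 * χ ^ 2) * χ * Q * ∑ h : ι × Bool, corr E J [o, foot E h] ≤
      ∑ x, ∑ y, ∑ z, joint E J o x y z
  change ∀ u, ∑ y, corr E J [y, u] = χ at hχ
  change ∀ h : ι × Bool, ∑ h' : ι × Bool, corr E J [foot E h, foot E h'] *
      bondSum E J h.1 h'.1 ≤ Q at hQ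
  have hχ' : ∀ u, ∑ y, corr E J [u, y] = χ := fun u => by
    rw [← hχ u]; exact Finset.sum_congr rfl fun y _ => corr_pair_comm E J u y
  have hχ0 : 0 ≤ χ := by rw [← hχ o]; exact Finset.sum_nonneg fun y _ => corr_nonneg E hJ _
  let Φ : ι → ℝ := fun e => ∑ y, ∑ z, truncated E J y z (E e).1 (E e).2
  let w : Finset V → V → ℝ := fun K x => if o ∈ K ∧ x ∈ K then clusterWeight E J K [o, x] else 0
  have hw : ∀ K x, 0 ≤ w K x := fun K x => by
    simp only [w]; split_ifs
    · exact clusterWeight_nonneg E hJ K _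
    · exact le_rfl
  have h1 : ∑ x, ∑ K, w K x * (t * β / 2 * (∑ h : ι × Bool,
      (if foot E h ∈ K then (1 : ℝ) else 0) * Φ h.1) -
      t ^ 2 * β ^ 2 * (3 * χ ^ 2) / 2 * ∑ h : ι × Bool, ∑ h' : ι × Bool,
        (if foot E h ∈ K ∧ foot E h' ∈ K then (1 : ℝ) else 0) * bondSum E J h.1 h'.1) ≤
      ∑ x, ∑ y, ∑ z, joint E J o x y z := by
    refine Finset.sum_le_sum fun x _ => ?_
    have h2 : ∑ y, ∑ z, joint E J o x y z = ∑ K, w K x * ∑ y, ∑ z, (corr E J [y, z] -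
        if y ∈ K ∨ z ∈ K then 0 else corr E (cut E J K) [y, z]) := by
      simp only [joint_eq, Finset.mul_sum]
      rw [Finset.sum_congr rfl fun y _ => Finset.sum_comm, Finset.sum_comm]
      refine Finset.sum_congr rfl fun K _ => Finset.sum_congr rfl fun y _ =>
        Finset.sum_congr rfl fun z _ => ?_
      simp only [w, ite_mul, zero_mul]
    rw [h2]
    refine Finset.sum_le_sum fun K _ => mul_le_mul_of_nonneg_left ?_ (hw K x)
    refine (sum_corr_sub_corr_cut_ge_foot E hβ K hχ ht).trans ?_
    refine Finset.sum_le_sum fun y _ => Finset.sum_le_sum fun z _ => ?_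
    -- When `y` or `z` lies in K, subtracting the cut correlation instead of 0 only lowers the
    -- bound.
    have := corr_cut_nonneg E hJ K [y, z]
    split_ifs
    · simp only [J] at this ⊢
      linarith
    · exact le_rfl
  have h3 : ∑ x, ∑ K, w K x * ∑ h : ι × Bool, (if foot E h ∈ K then (1 : ℝ) else 0) * Φ h.1 =
      χ * ∑ h : ι × Bool, corr E J [o, foot E h] * Φ h.1 := by
    have h4 : ∀ x, ∑ K, w K x * ∑ h : ι × Bool, (if foot E h ∈ K then (1 : ℝ) else 0) * Φ h.1 =
        ∑ h : ι × Bool, corr E J [o, foot E h] * corr E J [foot E h, x] * Φ h.1 := fun x => by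
      simp only [Finset.mul_sum]
      rw [Finset.sum_comm]
      refine Finset.sum_congr rfl fun h _ => ?_
      rw [← sum_clusterWeight_mem, Finset.sum_mul]
      refine Finset.sum_congr rfl fun K _ => ?_
      by_cases a : o ∈ K <;> by_cases b : x ∈ K <;> by_cases c : foot E h ∈ K <;>
        simp [w, a, b, c]
    simp only [h4]
    rw [Finset.sum_comm, Finset.mul_sum]
    refine Finset.sum_congr rfl fun h _ => ?_
    rw [← Finset.sum_mul, ← Finset.mul_sum, hχ']
    ring
  have h5 : ∑ x, ∑ K, w K x * ∑ h : ι × Bool, ∑ h' : ι × Bool,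
        (if foot E h ∈ K ∧ foot E h' ∈ K then (1 : ℝ) else 0) * bondSum E J h.1 h'.1 ≤
      2 * χ * Q * ∑ h : ι × Bool, corr E J [o, foot E h] := by
    have h6 : ∀ x, ∑ K, w K x * ∑ h : ι × Bool, ∑ h' : ι × Bool,
        (if foot E h ∈ K ∧ foot E h' ∈ K then (1 : ℝ) else 0) * bondSum E J h.1 h'.1 ≤
        ∑ h : ι × Bool, ∑ h' : ι × Bool,
          (corr E J [o, foot E h] * corr E J [foot E h, foot E h'] * corr E J [foot E h', x] +
          corr E J [o, foot E h'] * corr E J [foot E h', foot E h] * corr E J [foot E h, x]) *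
          bondSum E J h.1 h'.1 := fun x => by
      simp only [Finset.mul_sum]
      rw [Finset.sum_comm]
      refine Finset.sum_le_sum fun h _ => ?_
      rw [Finset.sum_comm]
      refine Finset.sum_le_sum fun h' _ => ?_
      -- Second moment over clusters. The two trees of the bound are exchanged by swapping the
      -- half-edges, which gives the factor 2.
      refine le_trans (le_of_eq ?_) (mul_le_mul_of_nonneg_right
        (sum_clusterWeight_mem_mem_le E hJ o x (foot E h) (foot E h'))
        (bondSum_nonneg E hJ h.1 h'.1))
      rw [Finset.sum_mul]
      refine Finset.sum_congr rfl fun K _ => ?_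
      by_cases a : o ∈ K <;> by_cases b : x ∈ K <;> by_cases c : foot E h ∈ K <;>
        by_cases c' : foot E h' ∈ K <;> simp [w, a, b, c, c']
    refine (Finset.sum_le_sum fun x _ => h6 x).trans ?_
    have h7 : ∑ x, ∑ h : ι × Bool, ∑ h' : ι × Bool,
          (corr E J [o, foot E h] * corr E J [foot E h, foot E h'] * corr E J [foot E h', x] +
          corr E J [o, foot E h'] * corr E J [foot E h', foot E h] * corr E J [foot E h, x]) *
          bondSum E J h.1 h'.1 =
        ∑ h : ι × Bool, ∑ h' : ι × Bool,
          (corr E J [o, foot E h] * corr E J [foot E h, foot E h'] * χ +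
          corr E J [o, foot E h'] * corr E J [foot E h', foot E h] * χ) *
          bondSum E J h.1 h'.1 := by
      rw [Finset.sum_comm]
      refine Finset.sum_congr rfl fun h _ => ?_
      rw [Finset.sum_comm]
      refine Finset.sum_congr rfl fun h' _ => ?_
      rw [← Finset.sum_mul, Finset.sum_add_distrib, ← Finset.mul_sum, ← Finset.mul_sum, hχ', hχ']
    rw [h7]
    simp only [add_mul, Finset.sum_add_distrib]
    have h8 : ∑ h : ι × Bool, ∑ h' : ι × Bool,
          corr E J [o, foot E h'] * corr E J [foot E h', foot E h] * χ * bondSum E J h.1 h'.1 =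
        ∑ h : ι × Bool, ∑ h' : ι × Bool,
          corr E J [o, foot E h] * corr E J [foot E h, foot E h'] * χ * bondSum E J h.1 h'.1 := by
      rw [Finset.sum_comm]
      refine Finset.sum_congr rfl fun h _ => Finset.sum_congr rfl fun h' _ => ?_
      rw [bondSum_comm]
    have h9 : ∑ h : ι × Bool, ∑ h' : ι × Bool,
          corr E J [o, foot E h] * corr E J [foot E h, foot E h'] * χ * bondSum E J h.1 h'.1 ≤
        χ * Q * ∑ h : ι × Bool, corr E J [o, foot E h] := by
      rw [Finset.mul_sum]
      refine Finset.sum_le_sum fun h _ => ?_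
      have := mul_le_mul_of_nonneg_left (hQ h) (mul_nonneg hχ0 (corr_nonneg E hJ [o, foot E h]))
      rw [Finset.mul_sum] at this
      calc _ = ∑ h' : ι × Bool, χ * corr E J [o, foot E h] *
              (corr E J [foot E h, foot E h'] * bondSum E J h.1 h'.1) :=
            Finset.sum_congr rfl fun h' _ => by ring
        _ ≤ _ := this
        _ = _ := by ring
    rw [h8]
    linarith
  refine le_trans ?_ h1
  have h10 : ∑ x, ∑ K, w K x * (t * β / 2 * (∑ h : ι × Bool,
      (if foot E h ∈ K then (1 : ℝ) else 0) * Φ h.1) -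
      t ^ 2 * β ^ 2 * (3 * χ ^ 2) / 2 * ∑ h : ι × Bool, ∑ h' : ι × Bool,
        (if foot E h ∈ K ∧ foot E h' ∈ K then (1 : ℝ) else 0) * bondSum E J h.1 h'.1) =
      t * β / 2 * (∑ x, ∑ K, w K x * ∑ h : ι × Bool,
        (if foot E h ∈ K then (1 : ℝ) else 0) * Φ h.1) -
      t ^ 2 * β ^ 2 * (3 * χ ^ 2) / 2 * ∑ x, ∑ K, w K x * ∑ h : ι × Bool, ∑ h' : ι × Bool,
        (if foot E h ∈ K ∧ foot E h' ∈ K then (1 : ℝ) else 0) * bondSum E J h.1 h'.1 := by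
    rw [Finset.mul_sum, Finset.mul_sum, ← Finset.sum_sub_distrib]
    refine Finset.sum_congr rfl fun x _ => ?_
    rw [Finset.mul_sum, Finset.mul_sum, ← Finset.sum_sub_distrib]
    refine Finset.sum_congr rfl fun K _ => ?_
    ring
  rw [h10, h3]
  have h11 := mul_le_mul_of_nonneg_left h5
    (show 0 ≤ t ^ 2 * β ^ 2 * (3 * χ ^ 2) / 2 by positivity)
  simp only [Φ]
  linarith

end Deficit

end PairIsing

/-! ### The torus: edges, translation invariance and the susceptibility -/

namespace TorusIsing

open Ising PairIsing

variable (d r : ℕ) [NeZero r]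

/-- The oriented unit edges of the torus. -/
def torusEdge (q : Torus d r × Fin d) : Torus d r × Torus d r := (q.1, q.1 + Pi.single q.2 1)

/-- Torus correlations with uniform coupling. -/
noncomputable def torusCorr (β : ℝ) (l : List (Torus d r)) : ℝ :=
  corr (torusEdge d r) (fun _ => β) l

variable {d r}

/-- For `3 ≤ r` both 1 and 1 + 1 are nonzero in `ZMod r`, so every unordered edge comes from exactly
one oriented unit edge; with r = 2 it would come from two. -/
theorem edgeFinset_sum_eq (hr : 3 ≤ r) (σ : SpinConfig (Torus d r)) :
    ∑ e ∈ (torusGraph d r).edgeFinset, (e.map (spin σ)).mul = ∑ q, bond (torusEdge d r) q σ := by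
  have h1 : (1 : ZMod r) ≠ 0 := by
    have : Fact (1 < r) := ⟨by omega⟩
    exact one_ne_zero
  have h2 : (1 : ZMod r) + 1 ≠ 0 := by
    intro h
    have h' : ((2 : ℕ) : ZMod r) = 0 := by
      rw [← h]; norm_num
    rw [ZMod.natCast_eq_zero_iff] at h'
    have := Nat.le_of_dvd (by norm_num) h'
    omega
  symm
  refine Finset.sum_nbij (fun q => s((torusEdge d r q).1, (torusEdge d r q).2)) ?_ ?_ ?_ ?_
  · rintro ⟨x, i⟩ _
    rw [SimpleGraph.mem_edgeFinset, SimpleGraph.mem_edgeSet, torusGraph, SimpleGraph.fromRel_adj]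
    refine ⟨fun h => h1 ?_, .inl ⟨i, rfl⟩⟩
    have := congrFun h i
    simpa [torusEdge] using this
  · rintro ⟨x, i⟩ _ ⟨y, j⟩ _ h
    simp only [torusEdge, Sym2.eq_iff] at h
    rcases h with ⟨rfl, h⟩ | ⟨rfl, h⟩
    · have h' := add_left_cancel h
      have := congrFun h' i
      simp only [Pi.single_eq_same, Pi.single_apply] at this
      by_cases hij : i = j
      · rw [hij]
      · rw [if_neg hij] at this
        exact absurd this h1
    · exfalso
      rw [add_assoc] at h
      have h' : Pi.single j (1 : ZMod r) + Pi.single i 1 = (0 : Torus d r) := by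
        simpa using h
      have := congrFun h' i
      simp only [Pi.add_apply, Pi.single_eq_same, Pi.single_apply, Pi.zero_apply] at this
      by_cases hij : i = j
      · rw [if_pos hij] at this
        exact h2 this
      · rw [if_neg hij, zero_add] at this
        exact h1 this
  · intro e he
    induction e using Sym2.ind with
    | _ x y =>
      rw [Finset.mem_coe, SimpleGraph.mem_edgeFinset, SimpleGraph.mem_edgeSet, torusGraph,
        SimpleGraph.fromRel_adj] at he
      rcases he.2 with ⟨i, hi⟩ | ⟨i, hi⟩
      · exact ⟨(x, i), by simp, by simp [torusEdge, hi]⟩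
      · exact ⟨(y, i), by simp, by simp [torusEdge, hi, Sym2.eq_swap]⟩
  · rintro ⟨x, i⟩ _
    simp [bond, Sym2.mul]

theorem expectation_eq (hr : 3 ≤ r) (β : ℝ) (l : List (Torus d r)) :
    expectation (torusGraph d r) β (spinProd l) = torusCorr d r β l := by
  have hw : ∀ σ : SpinConfig (Torus d r), Real.exp (-β * hamiltonian (torusGraph d r) σ) =
      weight (torusEdge d r) (fun _ => β) σ := fun σ => by
    rw [hamiltonian, edgeFinset_sum_eq hr, weight, ← Finset.mul_sum]
    ring_nf
  simp only [expectation, partitionFunction, hw, torusCorr, corr, part]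
  ring

theorem twoPoint_eq (hr : 3 ≤ r) (β : ℝ) (x y : Torus d r) :
    twoPoint d r β x y = torusCorr d r β [x, y] := by
  rw [← expectation_eq hr, twoPoint]
  congr 1
  ext σ
  simp

theorem fourPoint_eq (hr : 3 ≤ r) (β : ℝ) (w x y z : Torus d r) :
    fourPoint d r β w x y z = torusCorr d r β [w, x, y, z] := by
  rw [← expectation_eq hr, fourPoint]
  congr 1
  ext σ
  simp [mul_assoc]

theorem ursell4_eq (hr : 3 ≤ r) (β : ℝ) (w x y z : Torus d r) :
    ursell4 d r β w x y z = -2 * joint (torusEdge d r) (fun _ => β) w x y z := by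
  simp only [ursell4, fourPoint_eq hr, twoPoint_eq hr, torusCorr]
  rw [corr_four]
  ring

theorem torusCorr_translate (β : ℝ) (a : Torus d r) (l : List (Torus d r)) :
    torusCorr d r β (l.map (· + a)) = torusCorr d r β l := by
  let T : SpinConfig (Torus d r) ≃ SpinConfig (Torus d r) :=
    Equiv.arrowCongr (Equiv.addRight (-a)) (Equiv.refl ℤˣ)
  have hT : ∀ σ x, spin (T σ) x = spin σ (x + a) := fun σ x => by
    simp [T, spin, Equiv.arrowCongr]
  have hl : ∀ σ, spinProd l (T σ) = spinProd (l.map (· + a)) σ := fun σ => by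
    simp only [spinProd, List.map_map]
    congr 1
    exact List.map_congr_left fun x _ => by simp [hT]
  have hw : ∀ σ, weight (torusEdge d r) (fun _ => β) (T σ) =
      weight (torusEdge d r) (fun _ => β) σ := fun σ => by
    unfold weight
    rw [← Equiv.sum_comp ((Equiv.addRight a).prodCongr (Equiv.refl (Fin d)))
      (fun q => β * bond (torusEdge d r) q σ)]
    congr 1
    refine Finset.sum_congr rfl fun q _ => ?_
    simp [bond, hT, torusEdge, add_right_comm]
  simp only [torusCorr, corr]
  congr 1
  rw [← Equiv.sum_comp T (fun σ => spinProd l σ * weight (torusEdge d r) (fun _ => β) σ)]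
  simp only [hl, hw]

theorem torusCorr_pair_translate (β : ℝ) (a x y : Torus d r) :
    torusCorr d r β [x + a, y + a] = torusCorr d r β [x, y] :=
  torusCorr_translate β a [x, y]

/-- Used with the identity for the susceptibility and with squaring for the bubble. -/
theorem sum_torusCorr (hr : 3 ≤ r) (β : ℝ) (f : ℝ → ℝ) (u : Torus d r) :
    ∑ y, f (torusCorr d r β [u, y]) = ∑ y, f (twoPoint d r β 0 y) := by
  rw [← Equiv.sum_comp (Equiv.addRight u)]
  refine Finset.sum_congr rfl fun y _ => ?_
  rw [twoPoint_eq hr]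
  have := torusCorr_pair_translate β u 0 y
  rw [zero_add] at this
  simp [this]

theorem sum_torusCorr_left (hr : 3 ≤ r) (β : ℝ) (u : Torus d r) :
    ∑ y, torusCorr d r β [y, u] = susceptibility d r β := by
  simp only [torusCorr, corr_pair_comm (torusEdge d r) _ _ u]
  exact sum_torusCorr hr β id u

theorem truncated_translate (β : ℝ) (a x y u v : Torus d r) :
    truncated (torusEdge d r) (fun _ => β) (x + a) (y + a) (u + a) (v + a) =
      truncated (torusEdge d r) (fun _ => β) x y u v := by
  have h1 := torusCorr_translate β a [x, y, u, v]
  have h2 := torusCorr_translate β a [x, y]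
  have h3 := torusCorr_translate β a [u, v]
  simp only [torusCorr, List.map_cons, List.map_nil] at h1 h2 h3
  rw [truncated, h1, h2, h3, truncated]

/-- The derivative of the susceptibility as a sum of truncated correlations. -/
theorem hasDerivAt_susceptibility (hr : 3 ≤ r) (β : ℝ) :
    HasDerivAt (fun b => susceptibility d r b) (∑ x, ∑ q, truncated (torusEdge d r) (fun _ => β)
      0 x (torusEdge d r q).1 (torusEdge d r q).2) β := by
  simp only [susceptibility, twoPoint_eq hr, torusCorr]
  refine HasDerivAt.fun_sum fun x _ => ?_
  have := hasDerivAt_corr (torusEdge d r) (J := fun b _ => b) (J' := fun _ => 1) (s := β)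
    (fun e => hasDerivAt_id β) [0, x]
  simpa [truncated] using this

/-- The truncated correlations with a bond, summed over the pair of sites. -/
noncomputable def bondResponse (β : ℝ) (q : Torus d r × Fin d) : ℝ :=
  ∑ y, ∑ z, truncated (torusEdge d r) (fun _ => β) y z (torusEdge d r q).1 (torusEdge d r q).2

theorem bondResponse_eq (β : ℝ) (x : Torus d r) (i : Fin d) :
    bondResponse β (x, i) = bondResponse β ((0 : Torus d r), i) := by
  unfold bondResponse
  rw [← Equiv.sum_comp (Equiv.addRight x)]
  refine Finset.sum_congr rfl fun y _ => ?_
  rw [← Equiv.sum_comp (Equiv.addRight x)]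
  refine Finset.sum_congr rfl fun z _ => ?_
  rw [← truncated_translate β x y z]
  simp [torusEdge, add_comm]

/-- Double counting: in the sum over two sites and all edges, translate either the base of the edge
or the first site to 0. -/
theorem sum_bondResponse (hr : 3 ≤ r) (β : ℝ) :
    ∑ i, bondResponse β ((0 : Torus d r), i) = deriv (fun b => susceptibility d r b) β := by
  rw [(hasDerivAt_susceptibility hr β).deriv]
  have hN : (Fintype.card (Torus d r) : ℝ) ≠ 0 := by
    exact_mod_cast Fintype.card_ne_zero
  have h1 : ∑ q : Torus d r × Fin d, bondResponse β q =
      Fintype.card (Torus d r) * ∑ i, bondResponse β ((0 : Torus d r), i) := by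
    rw [Fintype.sum_prod_type]
    simp only [fun x => Finset.sum_congr rfl fun i (_ : i ∈ Finset.univ) =>
      bondResponse_eq (d := d) (r := r) β x i]
    simp
  have h2 : ∑ q : Torus d r × Fin d, bondResponse β q = Fintype.card (Torus d r) *
      ∑ x, ∑ q, truncated (torusEdge d r) (fun _ => β)
        0 x (torusEdge d r q).1 (torusEdge d r q).2 := by
    unfold bondResponse
    rw [Finset.sum_comm]
    have h3 : ∀ y : Torus d r, ∑ q : Torus d r × Fin d, ∑ z,
        truncated (torusEdge d r) (fun _ => β) y z (torusEdge d r q).1 (torusEdge d r q).2 =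
        ∑ x, ∑ q, truncated (torusEdge d r) (fun _ => β)
          0 x (torusEdge d r q).1 (torusEdge d r q).2 := fun y => by
      rw [Finset.sum_comm, ← Equiv.sum_comp (Equiv.addRight y)]
      refine Finset.sum_congr rfl fun x _ => ?_
      rw [← Equiv.sum_comp ((Equiv.addRight y).prodCongr (Equiv.refl (Fin d)))]
      refine Finset.sum_congr rfl fun q _ => ?_
      rw [← truncated_translate β y 0 x]
      simp [torusEdge, add_right_comm]
    simp [h3]
  exact mul_left_cancel₀ hN (h1.symm.trans h2)

theorem foot_torusEdge (x : Torus d r) (i : Fin d) (b : Bool) :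
    foot (torusEdge d r) ((x, i), b) = x + if b then 0 else Pi.single i 1 := by
  cases b <;> simp [foot, torusEdge]

/-- Sums over half-edges of functions of the foot and the direction. -/
theorem sum_foot (β : ℝ) (hr : 3 ≤ r) (g : Fin d → ℝ) :
    ∑ h : (Torus d r × Fin d) × Bool, torusCorr d r β [0, foot (torusEdge d r) h] * g h.1.2 =
      2 * susceptibility d r β * ∑ i, g i := by
  simp only [Fintype.sum_prod_type, foot_torusEdge]
  rw [Finset.sum_comm, Finset.mul_sum]
  refine Finset.sum_congr rfl fun i _ => ?_
  rw [Finset.sum_comm]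
  have h : ∀ a : Torus d r, ∑ x, torusCorr d r β [0, x + a] * g i =
      susceptibility d r β * g i := fun a => by
    have := Equiv.sum_comp (Equiv.addRight a) (fun x => torusCorr d r β [0, x])
    simp only [Equiv.coe_addRight] at this
    rw [← Finset.sum_mul, this, susceptibility]
    simp only [twoPoint_eq hr]
  simp only [h]
  simp
  ring

theorem sum_mul_le_bubble (hr : 3 ≤ r) (β : ℝ) (u v a b : Torus d r) :
    ∑ x, torusCorr d r β [u, x + a] * torusCorr d r β [v, x + b] ≤ bubble d r β := by
  have h : ∀ u a : Torus d r, ∑ x, torusCorr d r β [u, x + a] ^ 2 = bubble d r β := fun u a => by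
    have := Equiv.sum_comp (Equiv.addRight a) (fun x => torusCorr d r β [u, x] ^ 2)
    simp only [Equiv.coe_addRight] at this
    rw [this]
    exact sum_torusCorr hr β (· ^ 2) u
  calc _ ≤ ∑ x, (torusCorr d r β [u, x + a] ^ 2 / 2 + torusCorr d r β [v, x + b] ^ 2 / 2) :=
        Finset.sum_le_sum fun x _ => by
          nlinarith [sq_nonneg (torusCorr d r β [u, x + a] - torusCorr d r β [v, x + b])]
    _ = bubble d r β := by
        rw [Finset.sum_add_distrib, ← Finset.sum_div, ← Finset.sum_div, h, h]
        ring

/-- For each of the d directions there are two feet and four terms of `bondSum`, each costing one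
bubble by AM–GM and translation. -/
theorem sum_foot_bondSum_le (hr : 3 ≤ r) (β : ℝ) (h : (Torus d r × Fin d) × Bool) :
    ∑ h' : (Torus d r × Fin d) × Bool,
      torusCorr d r β [foot (torusEdge d r) h, foot (torusEdge d r) h'] *
        bondSum (torusEdge d r) (fun _ => β) h.1 h'.1 ≤ 8 * d * bubble d r β := by
  simp only [Fintype.sum_prod_type, foot_torusEdge]
  rw [Finset.sum_comm]
  have key : ∀ i : Fin d, ∑ x, ∑ b : Bool, torusCorr d r β [foot (torusEdge d r) h,
      x + if b then 0 else Pi.single i 1] *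
        bondSum (torusEdge d r) (fun _ => β) h.1 (x, i) ≤ 8 * bubble d r β := fun i => by
    rw [Finset.sum_comm]
    have hb : ∀ a : Torus d r, ∑ x, torusCorr d r β [foot (torusEdge d r) h, x + a] *
        bondSum (torusEdge d r) (fun _ => β) h.1 (x, i) ≤ 4 * bubble d r β := fun a => by
      have e1 := sum_mul_le_bubble hr β (foot (torusEdge d r) h) (torusEdge d r h.1).1 a 0
      have e2 := sum_mul_le_bubble hr β (foot (torusEdge d r) h) (torusEdge d r h.1).1 a
        (Pi.single i 1)
      have e3 := sum_mul_le_bubble hr β (foot (torusEdge d r) h) (torusEdge d r h.1).2 a 0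
      have e4 := sum_mul_le_bubble hr β (foot (torusEdge d r) h) (torusEdge d r h.1).2 a
        (Pi.single i 1)
      have : ∀ x : Torus d r, bondSum (torusEdge d r) (fun _ => β) h.1 (x, i) =
          torusCorr d r β [(torusEdge d r h.1).1, x + 0] +
          torusCorr d r β [(torusEdge d r h.1).1, x + Pi.single i 1] +
          torusCorr d r β [(torusEdge d r h.1).2, x + 0] +
          torusCorr d r β [(torusEdge d r h.1).2, x + Pi.single i 1] := fun x => by
        rw [add_zero]; rfl
      simp only [this, mul_add, Finset.sum_add_distrib]
      linarith
    rw [Fintype.sum_bool]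
    have h1 := hb 0
    have h2 := hb (Pi.single i 1)
    simp only [if_true, Bool.false_eq_true, if_false]
    linarith
  refine (Finset.sum_le_sum fun i _ => key i).trans (le_of_eq ?_)
  simp
  ring

/-- The one-parameter family of lower bounds on the summed Ursell function. -/
theorem sum_abs_ursell4_ge (hr : 3 ≤ r) {β : ℝ} (hβ : 0 ≤ β) {t : ℝ} (ht : t ∈ Set.Icc (0 : ℝ) 1) :
    2 * (t * (β * susceptibility d r β ^ 2 * deriv (fun b => susceptibility d r b) β) -
      t ^ 2 * (48 * d ^ 2 * β ^ 2 * susceptibility d r β ^ 4 * bubble d r β)) ≤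
      ∑ x, ∑ y, ∑ z, |ursell4 d r β 0 x y z| := by
  -- With Q = 8dB and total foot weight 2dχ, the error constant is 3 · 8d · 2d = 48d²; the outer
  -- factor 2 comes from U₄ = -2 `joint`.
  have h1 := sum_joint_ge (torusEdge d r) hβ 0 (sum_torusCorr_left hr β)
    (sum_foot_bondSum_le hr β) ht
  have h2 := sum_foot β hr (fun i => bondResponse β ((0 : Torus d r), i))
  have h3 := sum_foot (d := d) (r := r) β hr (fun _ => 1)
  simp only [mul_one, Finset.sum_const, Finset.card_univ, Fintype.card_fin, nsmul_eq_mul] at h3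
  rw [sum_bondResponse hr] at h2
  have h4 : ∑ h : (Torus d r × Fin d) × Bool, torusCorr d r β [0, foot (torusEdge d r) h] *
      bondResponse β ((0 : Torus d r), h.1.2) =
      ∑ h : (Torus d r × Fin d) × Bool,
        corr (torusEdge d r) (fun _ => β) [0, foot (torusEdge d r) h] *
        ∑ y, ∑ z, truncated (torusEdge d r) (fun _ => β) y z
          (torusEdge d r h.1).1 (torusEdge d r h.1).2 :=
    Finset.sum_congr rfl fun h _ => by
      rw [← bondResponse_eq β h.1.1 h.1.2]; rfl
  rw [h4] at h2
  unfold torusCorr at h3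
  rw [h2, h3] at h1
  have h5 : ∑ x, ∑ y, ∑ z, |ursell4 d r β 0 x y z| =
      2 * ∑ x, ∑ y, ∑ z, joint (torusEdge d r) (fun _ => β) 0 x y z := by
    simp only [Finset.mul_sum, ursell4_eq hr]
    refine Finset.sum_congr rfl fun x _ => Finset.sum_congr rfl fun y _ =>
      Finset.sum_congr rfl fun z _ => ?_
    have := joint_nonneg (torusEdge d r) (fun _ => hβ) 0 x y z
    rw [abs_mul, abs_of_nonneg this]
    norm_num
  rw [h5]
  linarith

end TorusIsing

/-! ### Choice of the parameter t -/

theorem proposition1p9 (d r : ℕ) [NeZero r] (hd : 1 ≤ d) (hr : 3 ≤ r) (β : ℝ) (hβ : 0 < β) :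
    DifferentiableAt ℝ (fun b : ℝ => TorusIsing.susceptibility d r b) β ∧
    (1 / (128 * (d : ℝ) ^ 2)) *
        min (β * TorusIsing.susceptibility d r β ^ 2 *
              deriv (fun b : ℝ => TorusIsing.susceptibility d r b) β)
            ((1 / TorusIsing.bubble d r β) *
              (deriv (fun b : ℝ => TorusIsing.susceptibility d r b) β) ^ 2)
      ≤ ∑ x : Torus d r, ∑ y : Torus d r, ∑ z : Torus d r,
          |TorusIsing.ursell4 d r β 0 x y z| := by
  have hder := TorusIsing.hasDerivAt_susceptibility (d := d) hr β
  refine ⟨hder.differentiableAt, ?_⟩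
  have hmain := fun t ht => TorusIsing.sum_abs_ursell4_ge (d := d) hr hβ.le (t := t) ht
  have hχ' : 0 ≤ deriv (fun b : ℝ => TorusIsing.susceptibility d r b) β := by
    rw [hder.deriv]
    exact Finset.sum_nonneg fun x _ => Finset.sum_nonneg fun q _ =>
      PairIsing.truncated_nonneg _ (fun _ => hβ.le) _ _ _ _
  have h00 : TorusIsing.twoPoint d r β 0 0 = 1 := by
    rw [TorusIsing.twoPoint_eq hr]
    exact PairIsing.corr_pair_self _ _ _
  have hχ : 0 < TorusIsing.susceptibility d r β := by
    have h := Finset.single_le_sum (f := fun x => TorusIsing.twoPoint d r β 0 x) (fun x _ => by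
      rw [TorusIsing.twoPoint_eq hr]
      exact PairIsing.corr_nonneg _ (fun _ => hβ.le) _) (Finset.mem_univ (0 : Torus d r))
    rw [h00] at h
    exact zero_lt_one.trans_le h
  have hB : 0 < TorusIsing.bubble d r β := by
    have h := Finset.single_le_sum (f := fun x => TorusIsing.twoPoint d r β 0 x ^ 2)
      (fun x _ => sq_nonneg _) (Finset.mem_univ (0 : Torus d r))
    rw [h00, one_pow] at h
    exact zero_lt_one.trans_le h
  set χ := TorusIsing.susceptibility d r β
  set D := deriv (fun b : ℝ => TorusIsing.susceptibility d r b) β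
  set B := TorusIsing.bubble d r β
  set S := ∑ x : Torus d r, ∑ y : Torus d r, ∑ z : Torus d r, |TorusIsing.ursell4 d r β 0 x y z|
  have hd' : (1 : ℝ) ≤ d := by exact_mod_cast hd
  have hdpos : (0 : ℝ) < d := by linarith
  set a := β * χ ^ 2 * D with ha
  set b := 48 * (d : ℝ) ^ 2 * β ^ 2 * χ ^ 4 * B with hb
  have ha0 : 0 ≤ a := by positivity
  have hb0 : 0 < b := by positivity
  have hS : 0 ≤ S := by
    have := hmain 0 (by simp)
    linarith
  rcases le_total a (2 * b) with hab | hab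
  -- The unconstrained maximiser of ta - t²b, giving a²/(2b) = D²/(96d²B), better than the required
  -- constant 128.
  · have h := hmain (a / (2 * b)) ⟨by positivity, (div_le_one (by positivity)).2 hab⟩
    have h1 : 2 * (a / (2 * b) * a - (a / (2 * b)) ^ 2 * b) = 1 / (96 * (d : ℝ) ^ 2) *
        ((1 / B) * D ^ 2) := by
      rw [ha, hb]
      field_simp
      ring
    rw [h1] at h
    refine le_trans ?_ h
    refine mul_le_mul ?_ (min_le_right _ _) (le_min ha0 (by positivity)) (by positivity)
    exact one_div_le_one_div_of_le (by positivity) (by nlinarith)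
  -- The maximiser is now at least 1; t = 1 gives 2(a - b) ≥ a.
  · have h := hmain 1 (by simp)
    have h1 : 1 / (128 * (d : ℝ) ^ 2) ≤ 1 := by
      rw [div_le_one (by positivity)]
      nlinarith
    calc _ ≤ 1 * a := mul_le_mul h1 (min_le_left _ _) (le_min ha0 (by positivity)) zero_le_one
      _ ≤ S := by linarith
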